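/- Let $n_+,n_-\ge 1$ be integers, $n=n_++n_-$, and let $G$ be the star graph with $n$ edges, each identified with $(0,1)$, with $0$ the central vertex and $1$ the outer vertices. Let $L^2(G)=\bigoplus_{j=1}^n L^2((0,1))$ (complex-valued functions), with the indefinite inner product $$[f,g]=\sum_{j=1}^{n_+}\int_0^1 f_j\overline{g_j}\,dt-\sum_{j=n_++1}^{n}\int_0^1 f_j\overline{g_j}\,dt .$$ Let $B$ be the indefinite Kirchhoff Laplacian: $(Bf)_j=-f_j''$ for $1\le j\le n_+$ and $(Bf)_j=f_j''$ for $n_++1\le j\le n$, with domain $$\mathcal D(B)=\Big\{f\in L^2(G): f_j\in H^2((0,1)),\ f_j(1)=0 \text{ for all } j,\ f_1(0)=\dots=f_n(0),\ \sum_{j=1}^n f_j'(0)=0\Big\}.$$ **Theorem.** $B$ is a positive operator in the Krein space $(L^2(G),[\cdot,\cdot])$, that is, $\mathcal D(B)$ is dense and $[Bf,f]>0$ for all $f\in\mathcal D(B)\setminus\{0\}$. Moreover $0\in\rho(B)$, and the spectrum of $B$ is purely discrete (it has no accumulation point in $\mathbb C$, and each point $\lambda$ of it is an eigenvalue of finite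 algebraic multiplicity for which the range of $B-\lambda$ is closed) and real. One has $$\sigma(B)=\sigma_p(B)=\{\eta_k:k\in\mathbb Z\setminus\{0\}\}\cup P_+\cup P_-,$$ where $P_+=\{(k\pi)^2:k\in\mathbb N\}$ if $n_+\ge2$ and $P_+=\emptyset$ if $n_+=1$; $P_-=\{-(k\pi)^2:k\in\mathbb N\}$ if $n_-\ge2$ and $P_-=\emptyset$ if $n_-=1$; $\mathbb N=\{1,2,\dots\}$; and $\eta_k$ is the unique solution of 1. $\coth\sqrt{\eta_k}=-\frac{n_+}{n_-}\cot\sqrt{\eta_k}$ in the interval $\big(((k-1)\pi)^2,(k\pi)^2\big)$ if $k\ge1$, 2. $\coth\sqrt{-\eta_k}=-\frac{n_-}{n_+}\cot\sqrt{-\eta_k}$ in the interval $\big(-(k\pi)^2,-((k+1)\pi)^2\big)$ if $k\le-1$. For $k\in\mathbb N$ the geometric and algebraic multiplicities of $(k\pi)^2$ are both $n_+-1$, and those of $-(k\pi)^2$ are both $n_--1$ (multiplicity $0$ meaning that the number is not an eigenvalue). Each $\eta_k$ has geometric and algebraic multiplicity $1$. The $\eta_k$ satisfy $$\eta_k-\Big(k\pi-\arctan\tfrac{n_+}{n_-}\Big)^2\to0\quad(k\to\infty),\qquad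 \eta_k+\Big(|k|\pi-\arctan\tfrac{n_-}{n_+}\Big)^2\to0\quad(k\to-\infty).$$ The spectrum of $B$ is symmetric with respect to the origin (that is, $\sigma(B)=-\sigma(B)$) if and only if $n_+=n_-$. -/

import Mathlib

open Set Filter Topology MeasureTheory
open scoped ContDiff ComplexConjugate

noncomputable section

/-! ## Unbounded operators on a complex Hilbert space -/

namespace UnboundedOperator

variable {H : Type*} [NormedAddCommGroup H] [InnerProductSpace ℂ H]

/-- The map `T - z`, defined on the domain of `T`. -/
def shift (T : H →ₗ.[ℂ] H) (z : ℂ) : T.domain →ₗ[ℂ] H :=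
  T.toFun - z • T.domain.subtype

/-- The resolvent set: all `z` such that `T - z` is a bijection from the domain of `T` onto `H`
with bounded everywhere defined inverse `R`. -/
def resolventSet (T : H →ₗ.[ℂ] H) : Set ℂ :=
  {z | ∃ R : H →L[ℂ] H,
    (∀ x : T.domain, R (shift T z x) = x) ∧
    (∀ y : H, ∃ x : T.domain, (x : H) = R y ∧ shift T z x = y)}

/-- The spectrum, the complement of the resolvent set. -/
def opSpectrum (T : H →ₗ.[ℂ] H) : Set ℂ := (resolventSet T)ᶜ

/-- The subspace `ker (T - z)` of `H`. -/
def eigenspace (T : H →ₗ.[ℂ] H) (z : ℂ) : Submodule ℂ H :=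
  (LinearMap.ker (shift T z)).map T.domain.subtype

/-- The point spectrum, the set of eigenvalues. -/
def pointSpectrum (T : H →ₗ.[ℂ] H) : Set ℂ := {z | eigenspace T z ≠ ⊥}

/-- The subspace `ker ((T - z) ^ m)` of `H`; the domain of the power is the natural one. -/
def kerPow (T : H →ₗ.[ℂ] H) (z : ℂ) : ℕ → Submodule ℂ H
  | 0 => ⊥
  | m + 1 => ((kerPow T z m).comap (shift T z)).map T.domain.subtype

/-- The root subspace (generalized eigenspace), the union of the kernels of all powers
of `T - z`. -/
def rootSubspace (T : H →ₗ.[ℂ] H) (z : ℂ) : Submodule ℂ H := ⨆ m : ℕ, kerPow T z m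

/-- `z` has geometric multiplicity `m` and algebraic multiplicity `m` (where `m = 0` means that
`z` is not an eigenvalue). -/
def HasMultiplicity (T : H →ₗ.[ℂ] H) (z : ℂ) (m : ℕ) : Prop :=
  Module.rank ℂ (eigenspace T z) = m ∧ Module.rank ℂ (rootSubspace T z) = m

/-- The spectrum is purely discrete: it has no accumulation point in `ℂ` and each of its points is
an eigenvalue `z` of finite algebraic multiplicity such that the range of `T - z` is closed. -/
def HasPurelyDiscreteSpectrum (T : H →ₗ.[ℂ] H) : Prop :=
  (∀ z : ℂ, ¬ AccPt z (𝓟 (opSpectrum T))) ∧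
  ∀ z ∈ opSpectrum T, z ∈ pointSpectrum T ∧ FiniteDimensional ℂ (rootSubspace T z) ∧
    IsClosed (LinearMap.range (shift T z) : Set H)

end UnboundedOperator

/-! ## Sobolev spaces on an edge -/

namespace StarGraph

/-- Lebesgue measure on the edge `(0, 1)`. -/
abbrev edgeMeasure : Measure ℝ := volume.restrict (Ioo (0 : ℝ) 1)

/-- The space `L²((0, 1))` of complex functions. -/
abbrev EdgeL2 : Type := Lp ℂ 2 edgeMeasure

/-- `g ∈ L²((0, 1))` is the weak derivative of `f ∈ L²((0, 1))`. -/
def HasWeakDeriv (f g : EdgeL2) : Prop :=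
  ∀ φ : ℝ → ℝ, ContDiff ℝ ∞ φ → HasCompactSupport φ → tsupport φ ⊆ Ioo (0 : ℝ) 1 →
    ∫ t in Ioo (0 : ℝ) 1, deriv φ t • f t = - ∫ t in Ioo (0 : ℝ) 1, φ t • g t

theorem integrable_smul_edge (f : EdgeL2) {φ : ℝ → ℝ} (hc : Continuous φ)
    (hs : HasCompactSupport φ) : Integrable (fun t => φ t • f t) edgeMeasure := by
  have hf : Integrable (f : ℝ → ℂ) edgeMeasure := (Lp.memLp f).integrable (by norm_num)
  obtain ⟨C, hC⟩ := hs.exists_bound_of_continuous hc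
  exact hf.bdd_smul C hc.aestronglyMeasurable (Eventually.of_forall hC)

theorem HasWeakDeriv.zero : HasWeakDeriv 0 0 := by
  intro φ _ _ _
  have h : ((0 : EdgeL2) : ℝ → ℂ) =ᵐ[edgeMeasure] 0 := Lp.coeFn_zero _ _ _
  have h1 : ∀ ψ : ℝ → ℝ, ∫ t in Ioo (0 : ℝ) 1, ψ t • (0 : EdgeL2) t = 0 := by
    intro ψ
    rw [integral_congr_ae (g := fun _ => (0 : ℂ))]
    · simp
    · filter_upwards [h] with t ht
      rw [ht, Pi.zero_apply, smul_zero]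
  rw [h1, h1, neg_zero]

theorem HasWeakDeriv.add {f₁ g₁ f₂ g₂ : EdgeL2} (h₁ : HasWeakDeriv f₁ g₁)
    (h₂ : HasWeakDeriv f₂ g₂) : HasWeakDeriv (f₁ + f₂) (g₁ + g₂) := by
  intro φ hφ hs ht
  have key : ∀ (a b : EdgeL2) {ψ : ℝ → ℝ}, Continuous ψ → HasCompactSupport ψ →
      ∫ t in Ioo (0 : ℝ) 1, ψ t • (a + b) t =
        (∫ t in Ioo (0 : ℝ) 1, ψ t • a t) + ∫ t in Ioo (0 : ℝ) 1, ψ t • b t := by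
    intro a b ψ hc hs
    rw [← integral_add (integrable_smul_edge a hc hs) (integrable_smul_edge b hc hs)]
    apply integral_congr_ae
    filter_upwards [Lp.coeFn_add a b] with t ht
    simp only [ht, Pi.add_apply, smul_add]
  rw [key _ _ (hφ.continuous_deriv (by simp)) hs.deriv, key _ _ hφ.continuous hs,
    h₁ φ hφ hs ht, h₂ φ hφ hs ht, neg_add]

theorem HasWeakDeriv.smul (c : ℂ) {f g : EdgeL2} (h : HasWeakDeriv f g) :
    HasWeakDeriv (c • f) (c • g) := by
  intro φ hφ hs ht
  have key : ∀ (a : EdgeL2) (ψ : ℝ → ℝ),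
      ∫ t in Ioo (0 : ℝ) 1, ψ t • (c • a) t = c • ∫ t in Ioo (0 : ℝ) 1, ψ t • a t := by
    intro a ψ
    rw [← integral_smul]
    apply integral_congr_ae
    filter_upwards [Lp.coeFn_smul c a] with t ht
    simp only [ht, Pi.smul_apply]
    rw [smul_comm]
  rw [key, key, h φ hφ hs ht, smul_neg]

theorem HasWeakDeriv.unique {f g₁ g₂ : EdgeL2} (h₁ : HasWeakDeriv f g₁)
    (h₂ : HasWeakDeriv f g₂) : g₁ = g₂ := by
  have hint : ∀ g : EdgeL2, Integrable (g : ℝ → ℂ) edgeMeasure := fun g =>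
    (Lp.memLp g).integrable (by norm_num)
  have hae : ∀ᵐ t ∂edgeMeasure, t ∈ Ioo (0 : ℝ) 1 → (g₁ t - g₂ t) = 0 := by
    apply isOpen_Ioo.ae_eq_zero_of_integral_contDiff_smul_eq_zero
    · exact ((hint g₁).sub (hint g₂)).locallyIntegrable.locallyIntegrableOn _
    · intro φ hφ hs ht
      simp only [smul_sub]
      rw [integral_sub (integrable_smul_edge g₁ hφ.continuous hs)
        (integrable_smul_edge g₂ hφ.continuous hs), sub_eq_zero]
      exact neg_injective ((h₁ φ hφ hs ht).symm.trans (h₂ φ hφ hs ht))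
  apply Lp.ext
  filter_upwards [hae, ae_restrict_mem measurableSet_Ioo] with t ht htm
  exact sub_eq_zero.mp (ht htm)

/-- The Sobolev space `H¹((0, 1))`. -/
def H1 : Submodule ℂ EdgeL2 where
  carrier := {f | ∃ g, HasWeakDeriv f g}
  zero_mem' := ⟨0, HasWeakDeriv.zero⟩
  add_mem' := by
    rintro f₁ f₂ ⟨g₁, h₁⟩ ⟨g₂, h₂⟩
    exact ⟨g₁ + g₂, h₁.add h₂⟩
  smul_mem' := by
    rintro c f ⟨g, h⟩
    exact ⟨c • g, h.smul c⟩

open Classical in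
/-- The weak derivative of `f ∈ H¹((0, 1))` (and `0` if `f` is not in `H¹((0, 1))`). -/
def weakDeriv (f : EdgeL2) : EdgeL2 :=
  if h : ∃ g, HasWeakDeriv f g then h.choose else 0

theorem weakDeriv_spec {f : EdgeL2} (hf : f ∈ H1) : HasWeakDeriv f (weakDeriv f) := by
  have h : ∃ g, HasWeakDeriv f g := hf
  rw [weakDeriv, dif_pos h]
  exact h.choose_spec

theorem HasWeakDeriv.weakDeriv_eq {f g : EdgeL2} (h : HasWeakDeriv f g) : weakDeriv f = g :=
  (weakDeriv_spec ⟨g, h⟩).unique h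

theorem weakDeriv_zero : weakDeriv 0 = 0 := HasWeakDeriv.zero.weakDeriv_eq

theorem weakDeriv_add {f g : EdgeL2} (hf : f ∈ H1) (hg : g ∈ H1) :
    weakDeriv (f + g) = weakDeriv f + weakDeriv g :=
  ((weakDeriv_spec hf).add (weakDeriv_spec hg)).weakDeriv_eq

theorem weakDeriv_smul (c : ℂ) {f : EdgeL2} (hf : f ∈ H1) :
    weakDeriv (c • f) = c • weakDeriv f :=
  ((weakDeriv_spec hf).smul c).weakDeriv_eq

/-- The Sobolev space `H²((0, 1))`: all `f ∈ H¹((0, 1))` with `f' ∈ H¹((0, 1))`. -/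
def H2 : Submodule ℂ EdgeL2 where
  carrier := {f | f ∈ H1 ∧ weakDeriv f ∈ H1}
  zero_mem' := ⟨H1.zero_mem, by rw [weakDeriv_zero]; exact H1.zero_mem⟩
  add_mem' := by
    rintro f g ⟨hf, hf'⟩ ⟨hg, hg'⟩
    exact ⟨H1.add_mem hf hg, by rw [weakDeriv_add hf hg]; exact H1.add_mem hf' hg'⟩
  smul_mem' := by
    rintro c f ⟨hf, hf'⟩
    exact ⟨H1.smul_mem c hf, by rw [weakDeriv_smul c hf]; exact H1.smul_mem c hf'⟩

/-- The continuous representative of `f` on `[0, 1]` takes the value `c` at the point `a`. Every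
`f ∈ H¹((0, 1))` has exactly one such representative. -/
def HasBoundaryValue (f : EdgeL2) (a : ℝ) (c : ℂ) : Prop :=
  ∃ u : ℝ → ℂ, ContinuousOn u (Icc (0 : ℝ) 1) ∧ f =ᵐ[edgeMeasure] u ∧ u a = c

theorem HasBoundaryValue.zero (a : ℝ) : HasBoundaryValue 0 a 0 :=
  ⟨0, continuousOn_const, Lp.coeFn_zero _ _ _, rfl⟩

theorem HasBoundaryValue.add {f g : EdgeL2} {a : ℝ} {c d : ℂ} (hf : HasBoundaryValue f a c)
    (hg : HasBoundaryValue g a d) : HasBoundaryValue (f + g) a (c + d) := by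
  obtain ⟨u, hu, hfu, rfl⟩ := hf
  obtain ⟨v, hv, hgv, rfl⟩ := hg
  exact ⟨u + v, hu.add hv, (Lp.coeFn_add f g).trans (hfu.add hgv), rfl⟩

theorem HasBoundaryValue.smul (b : ℂ) {f : EdgeL2} {a : ℝ} {c : ℂ}
    (hf : HasBoundaryValue f a c) : HasBoundaryValue (b • f) a (b * c) := by
  obtain ⟨u, hu, hfu, rfl⟩ := hf
  exact ⟨b • u, hu.const_smul b, (Lp.coeFn_smul b f).trans (hfu.const_smul b), rfl⟩

/-! ## The star graph -/

/-- The Hilbert space `L²(G) = ⨁ⱼ L²((0, 1))` of the star graph with `n` edges. In the edge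
parameter, `0` is the central vertex and `1` is an outer vertex. -/
abbrev GraphL2 (n : ℕ) : Type := PiLp 2 (fun _ : Fin n => EdgeL2)

/-- The sign of an edge: `1` on the first `np` edges and `-1` on the other `nm` edges. -/
def edgeSign (np nm : ℕ) (j : Fin (np + nm)) : ℂ := if (j : ℕ) < np then 1 else -1

/-- The indefinite inner product `[f, g] = ∑ⱼ ±∫ fⱼ(t) conj (gⱼ(t)) dt`. -/
def kreinForm (np nm : ℕ) (f g : GraphL2 (np + nm)) : ℂ :=
  ∑ j, edgeSign np nm j * ∫ t in Ioo (0 : ℝ) 1, f j t * conj (g j t)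

/-- `T` is a positive operator in the Krein space `(L²(G), [·,·])`: its domain is dense and
`[T f, f] > 0` for every nonzero `f` in its domain. -/
def IsKreinPositive (np nm : ℕ) (T : GraphL2 (np + nm) →ₗ.[ℂ] GraphL2 (np + nm)) : Prop :=
  Dense (T.domain : Set (GraphL2 (np + nm))) ∧
  ∀ f : T.domain, (f : GraphL2 (np + nm)) ≠ 0 →
    0 < (kreinForm np nm (T f) f).re ∧ (kreinForm np nm (T f) f).im = 0

/-- The domain of the Kirchhoff Laplacian: functions that are `H²` on every edge, vanish at the
outer vertices, are continuous at the central vertex, and whose outgoing derivatives at the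
central vertex sum up to `0`. -/
def kirchhoffDomain (n : ℕ) : Submodule ℂ (GraphL2 n) where
  carrier := {f | (∀ j, f j ∈ H2) ∧ (∀ j, HasBoundaryValue (f j) 1 0) ∧
    (∃ c : ℂ, ∀ j, HasBoundaryValue (f j) 0 c) ∧
    ∃ d : Fin n → ℂ, (∀ j, HasBoundaryValue (weakDeriv (f j)) 0 (d j)) ∧ ∑ j, d j = 0}
  zero_mem' := by
    refine ⟨fun j => H2.zero_mem, fun j => .zero 1, ⟨0, fun j => .zero 0⟩, 0, fun j => ?_, ?_⟩
    · rw [PiLp.zero_apply, weakDeriv_zero]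
      exact .zero 0
    · simp
  add_mem' := by
    rintro f g ⟨hf, hf1, ⟨c, hc⟩, d, hd, hd0⟩ ⟨hg, hg1, ⟨c', hc'⟩, d', hd', hd0'⟩
    refine ⟨fun j => H2.add_mem (hf j) (hg j), fun j => ?_, ⟨c + c', fun j => (hc j).add (hc' j)⟩,
      d + d', fun j => ?_, ?_⟩
    · have h := (hf1 j).add (hg1 j)
      rwa [add_zero] at h
    · rw [PiLp.add_apply, weakDeriv_add (hf j).1 (hg j).1]
      exact (hd j).add (hd' j)
    · simp only [Pi.add_apply, Finset.sum_add_distrib, hd0, hd0', add_zero]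
  smul_mem' := by
    rintro b f ⟨hf, hf1, ⟨c, hc⟩, d, hd, hd0⟩
    refine ⟨fun j => H2.smul_mem b (hf j), fun j => ?_, ⟨b * c, fun j => (hc j).smul b⟩,
      fun j => b * d j, fun j => ?_, ?_⟩
    · have h := (hf1 j).smul b
      rwa [mul_zero] at h
    · rw [PiLp.smul_apply, weakDeriv_smul b (hf j).1]
      exact (hd j).smul b
    · rw [← Finset.mul_sum, hd0, mul_zero]

/-- The indefinite Kirchhoff Laplacian `B`: `(B f)ⱼ = -fⱼ''` on the first `np` edges and
`(B f)ⱼ = fⱼ''` on the other `nm` edges. -/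
def indefiniteKirchhoff (np nm : ℕ) : GraphL2 (np + nm) →ₗ.[ℂ] GraphL2 (np + nm) where
  domain := kirchhoffDomain (np + nm)
  toFun :=
    { toFun := fun f => WithLp.toLp 2 fun j =>
        -(edgeSign np nm j • weakDeriv (weakDeriv ((f : GraphL2 (np + nm)) j)))
      map_add' := by
        rintro ⟨f, hf⟩ ⟨g, hg⟩
        ext1 j
        simp only [Submodule.coe_add, PiLp.add_apply]
        rw [weakDeriv_add (hf.1 j).1 (hg.1 j).1, weakDeriv_add (hf.1 j).2 (hg.1 j).2, smul_add,
          neg_add]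
      map_smul' := by
        rintro b ⟨f, hf⟩
        ext1 j
        simp only [Submodule.coe_smul, PiLp.smul_apply, RingHom.id_apply]
        rw [weakDeriv_smul b (hf.1 j).1, weakDeriv_smul b (hf.1 j).2, smul_comm, smul_neg] }

/-- The real hyperbolic cotangent. -/
def coth (x : ℝ) : ℝ := Real.cosh x / Real.sinh x

end StarGraph

end

/-! On an edge with sign ε = ±1 the equation (B - z) f = g is the ordinary differential equation f''
= -εz f - εg. Its solutions vanishing at the outer vertex are a particular solution, given by
variation of constants, plus a multiple of S(1 - t), where S is the sine-type solution. The
conditions at the central vertex then become a square linear system for the n coefficients and the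
common vertex value (`shift_eq_iff`, `vertexMap`). So B - z is governed by a finite matrix: its
range is closed for every z, injectivity already gives a bounded inverse
(`mem_resolventSet_of_eigenspace_eq_bot`), and the eigenspace is isomorphic to the kernel of the
matrix (`rank_eigenspace_eq`). In particular the spectrum consists of eigenvalues, without any
compactness argument.

Positivity comes from integration by parts (`kreinForm_apply_eq`): the sign in B cancels the sign in
the form, the vertex conditions remove the boundary terms, and [Bf, f] is the sum of the integrals
of |f'|². It follows that 0 is in the resolvent set, that the domain is dense, that eigenvalues are
real, and that there are no Jordan chains of length two (`shift_eq_zero_of_mem_eigenspace`), so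
algebraic and geometric multiplicities agree.

Only λ = s² and λ = -s² with s > 0 remain. The solutions are trigonometric on the N edges whose sign
is that of λ and hyperbolic on the other M. If sin s = 0, the vertex value and the hyperbolic
coefficients vanish and the trigonometric coefficients only have to sum to zero, which gives
dimension N - 1. Otherwise the vertex value determines all coefficients, and there is a (simple)
eigenvalue exactly when N cos s sinh s + M cosh s sin s = 0, that is coth s = -(N/M) cot s.

This secular equation is equivalent to s + arctan((N/M) tanh s) = kπ (`secular_iff_phase`). The left
side is strictly increasing, so there is one root for each k ≥ 1, lying between (k - 1)π and kπ. As
tanh s tends to 1 exponentially fast, the root approaches kπ - arctan(N/M) fast enough for the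
squares to approach each other too (`tendsto_secularRoot_sq_sub`). If the spectrum is symmetric, the
first root solves the secular equation and the one with N and M exchanged, which forces N = M. -/

noncomputable section

namespace StarGraph

/-! ### Absolutely continuous functions on the edge -/

/-- `u` is on `[0, 1]` an absolutely continuous function with almost everywhere derivative `v`. -/
structure IsPrimitive (u v : ℝ → ℂ) : Prop where
  int : IntervalIntegrable v volume 0 1
  eq : ∀ t ∈ Icc (0 : ℝ) 1, u t = u 0 + ∫ s in (0 : ℝ)..t, v s

/-- The real case, applied to the real and the imaginary part, which are recombined with the
constants 1 and I. -/
theorem _root_.IntervalIntegrable.absolutelyContinuous_integral_complex {v : ℝ → ℂ} {a b c : ℝ}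
    (h : IntervalIntegrable v volume a b) (hc : c ∈ uIcc a b) :
    AbsolutelyContinuousOnInterval (fun t => ∫ s in c..t, v s) a b := by
  have hconst : ∀ z : ℂ, AbsolutelyContinuousOnInterval (fun _ : ℝ => z) a b := fun z =>
    (LipschitzWith.const z).lipschitzOnWith.absolutelyContinuousOnInterval
  have hre : IntervalIntegrable (fun s => (v s).re) volume a b :=
    ⟨h.1.re, h.2.re⟩
  have him : IntervalIntegrable (fun s => (v s).im) volume a b :=
    ⟨h.1.im, h.2.im⟩
  have h1 := (hre.absolutelyContinuousOnInterval_intervalIntegral hc).smul (hconst 1)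
  have h2 := (him.absolutelyContinuousOnInterval_intervalIntegral hc).smul (hconst Complex.I)
  have h3 := h1.add h2
  unfold AbsolutelyContinuousOnInterval at h3 ⊢
  -- The recombined function equals the integral only on the interval, so the two are compared along
  -- families of subintervals of it.
  refine h3.congr' ?_
  have hev : ∀ᶠ E : ℕ × (ℕ → ℝ × ℝ) in AbsolutelyContinuousOnInterval.totalLengthFilter ⊓
      𝓟 (AbsolutelyContinuousOnInterval.disjWithin a b),
      E ∈ AbsolutelyContinuousOnInterval.disjWithin a b :=
    eventually_inf_principal.mpr (by simp)
  filter_upwards [hev] with E hE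
  have key : ∀ t ∈ uIcc a b, ((fun t => ∫ s in c..t, (v s).re) • (fun _ : ℝ => (1 : ℂ)) +
      (fun t => ∫ s in c..t, (v s).im) • (fun _ : ℝ => Complex.I)) t = ∫ s in c..t, v s := by
    intro t ht
    have hct : IntervalIntegrable v volume c t := h.mono_set (uIcc_subset_uIcc hc ht)
    have e1 : ∫ s in c..t, (v s).re = (∫ s in c..t, v s).re :=
      (Complex.reCLM.intervalIntegral_comp_comm hct)
    have e2 : ∫ s in c..t, (v s).im = (∫ s in c..t, v s).im :=
      (Complex.imCLM.intervalIntegral_comp_comm hct)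
    simp only [Pi.add_apply, Pi.smul_apply', e1, e2, Complex.real_smul, mul_one]
    exact Complex.re_add_im _
  refine Finset.sum_congr rfl fun i hi => ?_
  have hE' := hE.1 i hi
  rw [key _ hE'.1, key _ hE'.2]

namespace IsPrimitive

variable {u v u₁ v₁ u₂ v₂ : ℝ → ℂ}

theorem congr_eq (h : IsPrimitive u v) {w : ℝ → ℂ} (hw : ∀ t ∈ Icc (0 : ℝ) 1, w t = u t) :
    IsPrimitive w v :=
  ⟨h.int, fun t ht => by rw [hw t ht, hw 0 (by simp), h.eq t ht]⟩

theorem absolutelyContinuous (h : IsPrimitive u v) : AbsolutelyContinuousOnInterval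
    (fun t => u 0 + ∫ s in (0 : ℝ)..t, v s) 0 1 := by
  have hconst : AbsolutelyContinuousOnInterval (fun _ : ℝ => u 0) 0 1 :=
    (LipschitzWith.const _).lipschitzOnWith.absolutelyContinuousOnInterval
  exact hconst.add (h.int.absolutelyContinuous_integral_complex (by simp))

theorem continuousOn (h : IsPrimitive u v) : ContinuousOn u (Icc 0 1) := by
  have := h.absolutelyContinuous.continuousOn
  rw [uIcc_of_le zero_le_one] at this
  exact this.congr h.eq

theorem of_integral (hv : IntervalIntegrable v volume 0 1) (c : ℂ) :
    IsPrimitive (fun t => c + ∫ s in (0 : ℝ)..t, v s) v :=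
  ⟨hv, fun t _ => by simp⟩

theorem of_hasDerivAt (h : ∀ t, HasDerivAt u (v t) t) (hv : Continuous v) : IsPrimitive u v :=
  ⟨hv.intervalIntegrable _ _, fun t _ => by
    rw [intervalIntegral.integral_eq_sub_of_hasDerivAt (fun s _ => h s)
      (hv.intervalIntegrable _ _)]
    ring⟩

theorem intervalIntegrable_of_mem (h : IsPrimitive u v) {s t : ℝ} (hs : s ∈ Icc (0 : ℝ) 1)
    (ht : t ∈ Icc (0 : ℝ) 1) : IntervalIntegrable v volume s t :=
  h.int.mono_set (uIcc_subset_uIcc (by rwa [uIcc_of_le zero_le_one])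
    (by rwa [uIcc_of_le zero_le_one]))

theorem add (h₁ : IsPrimitive u₁ v₁) (h₂ : IsPrimitive u₂ v₂) :
    IsPrimitive (fun t => u₁ t + u₂ t) (fun t => v₁ t + v₂ t) :=
  ⟨h₁.int.add h₂.int, fun t ht => by
    rw [intervalIntegral.integral_add (h₁.intervalIntegrable_of_mem (by simp) ht)
      (h₂.intervalIntegrable_of_mem (by simp) ht), h₁.eq t ht, h₂.eq t ht]
    ring⟩

theorem const_mul (c : ℂ) (h : IsPrimitive u v) :
    IsPrimitive (fun t => c * u t) (fun t => c * v t) :=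
  ⟨h.int.const_mul c, fun t ht => by
    rw [intervalIntegral.integral_const_mul, h.eq t ht]
    ring⟩

theorem sub (h₁ : IsPrimitive u₁ v₁) (h₂ : IsPrimitive u₂ v₂) :
    IsPrimitive (fun t => u₁ t - u₂ t) (fun t => v₁ t - v₂ t) :=
  ⟨h₁.int.sub h₂.int, fun t ht => by
    rw [intervalIntegral.integral_sub (h₁.intervalIntegrable_of_mem (by simp) ht)
      (h₂.intervalIntegrable_of_mem (by simp) ht), h₁.eq t ht, h₂.eq t ht]
    ring⟩

theorem star (h : IsPrimitive u v) :
    IsPrimitive (fun t => conj (u t)) (fun t => conj (v t)) := by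
  refine ⟨⟨?_, ?_⟩, fun t ht => ?_⟩
  · exact (Complex.conjCLE.toContinuousLinearMap.integrable_comp h.int.1)
  · exact (Complex.conjCLE.toContinuousLinearMap.integrable_comp h.int.2)
  · have := Complex.conjCLE.toContinuousLinearMap.intervalIntegral_comp_comm
      (h.intervalIntegrable_of_mem (s := 0) (by simp) ht)
    simp only [ContinuousLinearEquiv.coe_coe, Complex.conjCLE_apply] at this
    rw [this, h.eq t ht, map_add]

/-- The product rule. -/
theorem mul (h₁ : IsPrimitive u₁ v₁) (h₂ : IsPrimitive u₂ v₂) :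
    IsPrimitive (fun t => u₁ t * u₂ t) (fun t => v₁ t * u₂ t + u₁ t * v₂ t) := by
  have hint : IntervalIntegrable (fun t => v₁ t * u₂ t + u₁ t * v₂ t) volume 0 1 := by
    refine (h₁.int.mul_continuousOn ?_).add (h₂.int.continuousOn_mul ?_)
    · rw [uIcc_of_le zero_le_one]; exact h₂.continuousOn
    · rw [uIcc_of_le zero_le_one]; exact h₁.continuousOn
  refine ⟨hint, ?_⟩
  -- The product minus the integral of the candidate derivative is absolutely continuous and, by
  -- Lebesgue differentiation, has derivative zero almost everywhere; hence it is constant.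
  have hac := (h₁.absolutelyContinuous.smul h₂.absolutelyContinuous).sub
    (hint.absolutelyContinuous_integral_complex (c := 0) (by simp))
  obtain ⟨C, hC⟩ := hac.const_of_ae_hasDerivAt_zero (by
    filter_upwards [h₁.int.ae_hasDerivAt_integral, h₂.int.ae_hasDerivAt_integral,
      hint.ae_hasDerivAt_integral] with t ht₁ ht₂ ht₃ htm
    have d := (((ht₁ htm 0 (by simp)).const_add (u₁ 0)).mul
      ((ht₂ htm 0 (by simp)).const_add (u₂ 0))).sub (ht₃ htm 0 (by simp))
    rw [uIcc_of_le zero_le_one] at htm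
    rw [← h₁.eq t htm, ← h₂.eq t htm, sub_self] at d
    exact d)
  rw [uIcc_of_le zero_le_one] at hC
  intro t ht
  have e0 := hC 0 (by simp)
  have e1 := hC t ht
  simp only [Pi.sub_apply, smul_eq_mul, Pi.mul_apply, ← h₁.eq t ht, ← h₂.eq t ht,
    intervalIntegral.integral_same, add_zero, sub_zero] at e0 e1
  rw [e0, ← e1]
  ring

theorem integral_eq (h : IsPrimitive u v) {s t : ℝ} (hs : s ∈ Icc (0 : ℝ) 1)
    (ht : t ∈ Icc (0 : ℝ) 1) : ∫ x in s..t, v x = u t - u s := by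
  rw [h.eq t ht, h.eq s hs, ← intervalIntegral.integral_add_adjacent_intervals
    (h.intervalIntegrable_of_mem (s := 0) (by simp) hs) (h.intervalIntegrable_of_mem hs ht)]
  ring

theorem integral_Ioo (h : IsPrimitive u v) : ∫ x in Ioo (0 : ℝ) 1, v x = u 1 - u 0 := by
  rw [← integral_Ioc_eq_integral_Ioo, ← intervalIntegral.integral_of_le zero_le_one,
    h.integral_eq (by simp) (by simp)]

theorem eq_of_deriv_zero (h : IsPrimitive u v) (hv : ∀ t, v t = 0) {s t : ℝ}
    (hs : s ∈ Icc (0 : ℝ) 1) (ht : t ∈ Icc (0 : ℝ) 1) : u s = u t := by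
  have := h.integral_eq hs ht
  simp only [hv, intervalIntegral.integral_zero] at this
  exact (sub_eq_zero.mp this.symm).symm

end IsPrimitive

/-! ### Square integrable classes and their continuous representatives -/

theorem intervalIntegrable_iff_edge {v : ℝ → ℂ} :
    IntervalIntegrable v volume 0 1 ↔ Integrable v edgeMeasure := by
  rw [intervalIntegrable_iff_integrableOn_Ioo_of_le zero_le_one]
  rfl

theorem integrable_edge (f : EdgeL2) : Integrable (f : ℝ → ℂ) edgeMeasure :=
  (Lp.memLp f).integrable (by norm_num)

theorem memLp_edge_of_continuousOn {u : ℝ → ℂ} (hu : ContinuousOn u (Icc 0 1)) :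
    MemLp u 2 edgeMeasure := by
  obtain ⟨C, hC⟩ := isCompact_Icc.exists_bound_of_continuousOn hu
  refine MemLp.of_bound ((hu.mono Ioo_subset_Icc_self).aestronglyMeasurable measurableSet_Ioo) C ?_
  filter_upwards [ae_restrict_mem measurableSet_Ioo] with t ht
  exact hC t (Ioo_subset_Icc_self ht)

theorem eqOn_of_ae_eq_edge {u v : ℝ → ℂ} (hu : ContinuousOn u (Icc 0 1))
    (hv : ContinuousOn v (Icc 0 1)) (h : u =ᵐ[edgeMeasure] v) : EqOn u v (Icc 0 1) := by
  have h' : u =ᵐ[volume.restrict (Icc (0 : ℝ) 1)] v := by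
    rwa [← restrict_Ioo_eq_restrict_Icc]
  exact Measure.eqOn_Icc_of_ae_eq volume (by norm_num) h' hu hv

/-- Continuous functions that agree almost everywhere on the open edge agree on the closed one, so
any continuous representative may be used to read off the value. -/
theorem hasBoundaryValue_iff {f : EdgeL2} {u : ℝ → ℂ} (hu : ContinuousOn u (Icc 0 1))
    (h : f =ᵐ[edgeMeasure] u) {a : ℝ} (ha : a ∈ Icc (0 : ℝ) 1) {c : ℂ} :
    HasBoundaryValue f a c ↔ u a = c := by
  constructor
  · rintro ⟨w, hw, hfw, rfl⟩
    exact eqOn_of_ae_eq_edge hu hw (h.symm.trans hfw) ha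
  · intro hc
    exact ⟨u, hu, h, hc⟩

/-! ### Weak derivatives and absolutely continuous representatives -/

/-- A test function with integral `0` is the derivative of a test function. -/
theorem exists_primitive_test {φ : ℝ → ℝ} (hφ : ContDiff ℝ ∞ φ) (hs : HasCompactSupport φ)
    (ht : tsupport φ ⊆ Ioo (0 : ℝ) 1) (h0 : ∫ t in (0 : ℝ)..1, φ t = 0) :
    ∃ ψ : ℝ → ℝ, ContDiff ℝ ∞ ψ ∧ HasCompactSupport ψ ∧ tsupport ψ ⊆ Ioo (0 : ℝ) 1 ∧
      deriv ψ = φ := by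
  obtain ⟨a, b, ha, hb, hab, hsub⟩ : ∃ a b : ℝ, 0 < a ∧ b < 1 ∧ a ≤ b ∧ tsupport φ ⊆ Icc a b := by
    rcases (tsupport φ).eq_empty_or_nonempty with he | hne
    · exact ⟨1/2, 1/2, by norm_num, by norm_num, le_rfl, by simp [he]⟩
    · have hc : IsCompact (tsupport φ) := hs
      refine ⟨sInf (tsupport φ), sSup (tsupport φ), (ht (hc.sInf_mem hne)).1,
        (ht (hc.sSup_mem hne)).2, ?_, fun x hx => ⟨csInf_le hc.bddBelow hx,
          le_csSup hc.bddAbove hx⟩⟩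
      exact csInf_le hc.bddBelow (hc.sSup_mem hne)
  have hz : ∀ t, t ∉ Icc a b → φ t = 0 := fun t h =>
    image_eq_zero_of_notMem_tsupport fun h' => h (hsub h')
  have hint : ∀ s t, IntervalIntegrable φ volume s t := fun s t =>
    hφ.continuous.intervalIntegrable s t
  have hder : ∀ t, HasDerivAt (fun t => ∫ s in (0 : ℝ)..t, φ s) (φ t) t := fun t =>
    intervalIntegral.integral_hasDerivAt_right (hint _ _)
      (hφ.continuous.stronglyMeasurableAtFilter _ _) hφ.continuous.continuousAt
  -- To the left of `a` the integrand vanishes; to the right of `b` the integral is the full one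
  -- over the edge, which is zero by assumption.
  have hzero : ∀ t, t ∉ Icc a b → ∫ s in (0 : ℝ)..t, φ s = 0 := by
    intro t h
    rw [mem_Icc, not_and_or, not_le, not_le] at h
    rcases h with h | h
    · rw [intervalIntegral.integral_zero_ae]
      refine Eventually.of_forall fun s hs => hz s fun hs' => ?_
      have : s ≤ max 0 t := hs.2
      have := hs'.1
      rcases max_cases 0 t with h3 | h3 <;> linarith
    · rw [← intervalIntegral.integral_add_adjacent_intervals (hint 0 1) (hint 1 t), h0, zero_add,
        intervalIntegral.integral_zero_ae]
      refine Eventually.of_forall fun s hs => hz s fun hs' => ?_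
      have : min 1 t < s := hs.1
      have := hs'.2
      rcases min_cases 1 t with h3 | h3 <;> linarith
  have hsupp : tsupport (fun t => ∫ s in (0 : ℝ)..t, φ s) ⊆ Icc a b := by
    refine closure_minimal (fun t h => ?_) isClosed_Icc
    by_contra h'
    exact h (hzero t h')
  have hd : deriv (fun t => ∫ s in (0 : ℝ)..t, φ s) = φ := funext fun t => (hder t).deriv
  refine ⟨fun t => ∫ s in (0 : ℝ)..t, φ s, ?_, ?_, ?_, hd⟩
  · rw [contDiff_infty_iff_deriv, hd]
    exact ⟨fun t => (hder t).differentiableAt, hφ⟩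
  · exact isCompact_Icc.of_isClosed_subset (isClosed_tsupport _) hsupp
  · exact hsupp.trans fun t h => ⟨ha.trans_le h.1, h.2.trans_lt hb⟩

theorem exists_test_integral_one : ∃ φ : ℝ → ℝ, ContDiff ℝ ∞ φ ∧ HasCompactSupport φ ∧
    tsupport φ ⊆ Ioo (0 : ℝ) 1 ∧ ∫ t in (0 : ℝ)..1, φ t = 1 := by
  let b : ContDiffBump (1 / 2 : ℝ) := ⟨1 / 8, 1 / 4, by norm_num, by norm_num⟩
  have hsub : tsupport (b.normed volume) ⊆ Ioo (0 : ℝ) 1 := by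
    rw [b.tsupport_normed_eq, Real.closedBall_eq_Icc]
    intro t ht
    have h1 := ht.1
    have h2 := ht.2
    simp only [b] at h1 h2
    constructor <;> linarith
  refine ⟨b.normed volume, b.contDiff_normed, b.hasCompactSupport_normed, hsub, ?_⟩
  rw [intervalIntegral.integral_of_le zero_le_one, setIntegral_eq_integral_of_forall_compl_eq_zero,
    b.integral_normed]
  intro t ht
  exact image_eq_zero_of_notMem_tsupport fun h => ht (Ioo_subset_Ioc_self (hsub h))

theorem integral_Ioo_eq_interval {E : Type*} [NormedAddCommGroup E] [NormedSpace ℝ E]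
    (f : ℝ → E) : ∫ t in Ioo (0 : ℝ) 1, f t = ∫ t in (0 : ℝ)..1, f t := by
  rw [intervalIntegral.integral_of_le zero_le_one, integral_Ioc_eq_integral_Ioo]

theorem IsPrimitive.congr_ae {u v w : ℝ → ℂ} (h : IsPrimitive u v) (hw : v =ᵐ[edgeMeasure] w) :
    IsPrimitive u w := by
  refine ⟨intervalIntegrable_iff_edge.mpr ((intervalIntegrable_iff_edge.mp h.int).congr hw),
    fun t ht => ?_⟩
  rw [h.eq t ht]
  congr 1
  refine intervalIntegral.integral_congr_ae ?_
  have h1 := (ae_restrict_iff' measurableSet_Ioo).mp hw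
  -- The edge measure ignores the endpoint 1, which the interval integral may include.
  have h2 : ∀ᵐ s : ℝ, s ≠ 1 := by simp [ae_iff, measure_singleton]
  filter_upwards [h1, h2] with s hs hs1 hsm
  rw [uIoc_of_le ht.1] at hsm
  exact hs ⟨hsm.1, lt_of_le_of_ne (hsm.2.trans ht.2) hs1⟩

/-- The lemma of du Bois-Reymond. -/
theorem ae_eq_const_of_forall_integral_deriv {w : ℝ → ℂ} (hw : Integrable w edgeMeasure)
    (h : ∀ φ : ℝ → ℝ, ContDiff ℝ ∞ φ → HasCompactSupport φ → tsupport φ ⊆ Ioo (0 : ℝ) 1 →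
      ∫ t in Ioo (0 : ℝ) 1, deriv φ t • w t = 0) : ∃ c : ℂ, w =ᵐ[edgeMeasure] fun _ => c := by
  obtain ⟨φ₀, hφ₀, hs₀, ht₀, h₀⟩ := exists_test_integral_one
  have hi : ∀ {φ : ℝ → ℝ} {w : ℝ → ℂ}, Integrable w edgeMeasure → ContDiff ℝ ∞ φ →
      HasCompactSupport φ → Integrable (fun t => φ t • w t) edgeMeasure := by
    intro φ w hw hφ hs
    obtain ⟨C, hC⟩ := hs.exists_bound_of_continuous hφ.continuous
    exact hw.bdd_smul C hφ.continuous.aestronglyMeasurable (Eventually.of_forall hC)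
  set c : ℂ := ∫ t in Ioo (0 : ℝ) 1, φ₀ t • w t with hc
  refine ⟨c, ?_⟩
  have hae : ∀ᵐ t ∂edgeMeasure, t ∈ Ioo (0 : ℝ) 1 → w t - c = 0 := by
    apply isOpen_Ioo.ae_eq_zero_of_integral_contDiff_smul_eq_zero
    · exact (hw.sub (integrable_const c)).locallyIntegrable.locallyIntegrableOn _
    · intro φ hφ hs ht
      set m : ℝ := ∫ t in (0 : ℝ)..1, φ t with hm
      -- Subtracting `m` times the normalized bump `φ₀` makes the integral zero, so the difference
      -- is the derivative of a test function and is annihilated by `w`.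
      obtain ⟨ψ, h1, h2, h3, h4⟩ := exists_primitive_test (φ := fun t => φ t - m * φ₀ t)
        (hφ.sub (contDiff_const.mul hφ₀)) (hs.sub (hs₀.mul_left (f := fun _ => m)))
        ((tsupport_sub _ _).trans (union_subset ht ((tsupport_mul_subset_right).trans ht₀)))
        (by
          rw [intervalIntegral.integral_sub (hφ.continuous.intervalIntegrable _ _)
            ((hφ₀.continuous.intervalIntegrable _ _).const_mul m),
            intervalIntegral.integral_const_mul, h₀, mul_one, sub_self])
      have h5 := h ψ h1 h2 h3
      rw [h4] at h5
      simp only [sub_smul, mul_smul] at h5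
      rw [integral_sub (hi hw hφ hs) (by exact (hi hw hφ₀ hs₀).smul m), integral_smul, ← hc,
        sub_eq_zero] at h5
      simp only [smul_sub]
      rw [integral_sub (hi hw hφ hs) (hi (integrable_const c) hφ hs), h5, integral_smul_const,
        integral_Ioo_eq_interval, ← hm, sub_self]
  filter_upwards [hae, ae_restrict_mem measurableSet_Ioo] with t ht htm
  exact sub_eq_zero.mp (ht htm)

/-- The product rule for `φ` and `u`, integrated over the edge; the boundary terms vanish with `φ`.
-/
theorem IsPrimitive.hasWeakDeriv {f g : EdgeL2} {u v : ℝ → ℂ} (h : IsPrimitive u v)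
    (hf : f =ᵐ[edgeMeasure] u) (hg : g =ᵐ[edgeMeasure] v) : HasWeakDeriv f g := by
  intro φ hφ hs ht
  have hφd : ∀ t, HasDerivAt (fun t => (φ t : ℂ)) ((deriv φ t : ℝ) : ℂ) t := fun t =>
    ((hφ.differentiable (by simp)) t).hasDerivAt.ofReal_comp
  have hp : IsPrimitive (fun t => (φ t : ℂ)) (fun t => ((deriv φ t : ℝ) : ℂ)) :=
    .of_hasDerivAt hφd (Complex.continuous_ofReal.comp (hφ.continuous_deriv (by simp)))
  have hm := (hp.mul h).integral_Ioo
  have hz : ∀ t, t ∉ Ioo (0 : ℝ) 1 → φ t = 0 := fun t h' =>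
    image_eq_zero_of_notMem_tsupport fun h'' => h' (ht h'')
  rw [hz 0 (by simp), hz 1 (by simp)] at hm
  simp only [Complex.ofReal_zero, zero_mul, sub_self] at hm
  have e1 : ∫ t in Ioo (0 : ℝ) 1, deriv φ t • f t
      = ∫ t in Ioo (0 : ℝ) 1, ((deriv φ t : ℝ) : ℂ) * u t :=
    integral_congr_ae (by filter_upwards [hf] with t ht; rw [ht, Complex.real_smul])
  have e2 : ∫ t in Ioo (0 : ℝ) 1, φ t • g t = ∫ t in Ioo (0 : ℝ) 1, (φ t : ℂ) * v t :=
    integral_congr_ae (by filter_upwards [hg] with t ht; rw [ht, Complex.real_smul])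
  have i1 := integrable_smul_edge f (hφ.continuous_deriv (by simp)) hs.deriv
  have i2 := integrable_smul_edge g hφ.continuous hs
  rw [e1, e2, eq_neg_iff_add_eq_zero, ← integral_add, hm]
  · exact i1.congr (by filter_upwards [hf] with t ht; rw [ht, Complex.real_smul])
  · exact i2.congr (by filter_upwards [hg] with t ht; rw [ht, Complex.real_smul])

/-- The difference of `f` and the primitive of `g` starting at 0 has weak derivative zero, hence is
constant by du Bois-Reymond. -/
theorem HasWeakDeriv.exists_primitive {f g : EdgeL2} (h : HasWeakDeriv f g) :
    ∃ u : ℝ → ℂ, f =ᵐ[edgeMeasure] u ∧ IsPrimitive u g := by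
  have hg : IntervalIntegrable (g : ℝ → ℂ) volume 0 1 :=
    intervalIntegrable_iff_edge.mpr (integrable_edge g)
  have hp := IsPrimitive.of_integral hg 0
  have hmem := memLp_edge_of_continuousOn hp.continuousOn
  have hw := hp.hasWeakDeriv hmem.coeFn_toLp Filter.EventuallyEq.rfl
  obtain ⟨c, hc⟩ := ae_eq_const_of_forall_integral_deriv
    ((integrable_edge f).sub (integrable_edge (hmem.toLp _))) (by
      intro φ hφ hs ht
      simp only [Pi.sub_apply, smul_sub]
      rw [integral_sub (integrable_smul_edge f (hφ.continuous_deriv (by simp)) hs.deriv)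
        (integrable_smul_edge _ (hφ.continuous_deriv (by simp)) hs.deriv), h φ hφ hs ht,
        hw φ hφ hs ht, sub_self])
  refine ⟨fun t => c + ∫ s in (0 : ℝ)..t, g s, ?_, .of_integral hg c⟩
  filter_upwards [hc, hmem.coeFn_toLp] with t h1 h2
  rw [Pi.sub_apply, h2, sub_eq_iff_eq_add, zero_add] at h1
  exact h1

/-- `u` and `u'` are the absolutely continuous representatives of `f ∈ H²` and of its weak
derivative, and `g` is the second weak derivative. -/
structure IsH2Rep (f : EdgeL2) (u u' : ℝ → ℂ) (g : EdgeL2) : Prop where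
  ae_eq : f =ᵐ[edgeMeasure] u
  prim : IsPrimitive u u'
  prim' : IsPrimitive u' g

namespace IsH2Rep

variable {f g : EdgeL2} {u u' : ℝ → ℂ}

theorem weakDeriv_ae_eq (h : IsH2Rep f u u' g) : f ∈ H1 ∧ weakDeriv f =ᵐ[edgeMeasure] u' := by
  have hm := memLp_edge_of_continuousOn h.prim'.continuousOn
  have hw : HasWeakDeriv f (hm.toLp u') := h.prim.hasWeakDeriv h.ae_eq hm.coeFn_toLp
  exact ⟨⟨_, hw⟩, by rw [hw.weakDeriv_eq]; exact hm.coeFn_toLp⟩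

theorem hasWeakDeriv_weakDeriv (h : IsH2Rep f u u' g) : HasWeakDeriv (weakDeriv f) g :=
  h.prim'.hasWeakDeriv h.weakDeriv_ae_eq.2 Filter.EventuallyEq.rfl

theorem mem_H2 (h : IsH2Rep f u u' g) : f ∈ H2 :=
  ⟨h.weakDeriv_ae_eq.1, g, h.hasWeakDeriv_weakDeriv⟩

theorem weakDeriv_weakDeriv (h : IsH2Rep f u u' g) : weakDeriv (weakDeriv f) = g :=
  h.hasWeakDeriv_weakDeriv.weakDeriv_eq

theorem hasBoundaryValue_iff (h : IsH2Rep f u u' g) {a : ℝ} (ha : a ∈ Icc (0 : ℝ) 1) {c : ℂ} :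
    HasBoundaryValue f a c ↔ u a = c :=
  StarGraph.hasBoundaryValue_iff h.prim.continuousOn h.ae_eq ha

theorem hasBoundaryValue_deriv_iff (h : IsH2Rep f u u' g) {a : ℝ} (ha : a ∈ Icc (0 : ℝ) 1)
    {c : ℂ} : HasBoundaryValue (weakDeriv f) a c ↔ u' a = c :=
  StarGraph.hasBoundaryValue_iff h.prim'.continuousOn h.weakDeriv_ae_eq.2 ha

end IsH2Rep

theorem exists_isH2Rep {f : EdgeL2} (hf : f ∈ H2) :
    ∃ u u', IsH2Rep f u u' (weakDeriv (weakDeriv f)) := by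
  obtain ⟨u, hu, hp⟩ := (weakDeriv_spec hf.1).exists_primitive
  obtain ⟨u', hu', hp'⟩ := (weakDeriv_spec hf.2).exists_primitive
  exact ⟨u, u', hu, hp.congr_ae hu', hp'⟩

/-- Reduces the conditions on classes to pointwise equations at the vertices, which is the form that
the differential equation and the integration by parts need. -/
theorem mem_kirchhoffDomain_iff {n : ℕ} {f g : GraphL2 n} {u u' : Fin n → ℝ → ℂ}
    (h : ∀ j, IsH2Rep (f j) (u j) (u' j) (g j)) :
    f ∈ kirchhoffDomain n ↔ (∀ j, u j 1 = 0) ∧ (∃ c, ∀ j, u j 0 = c) ∧ ∑ j, u' j 0 = 0 := by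
  have h0 : (0 : ℝ) ∈ Icc (0 : ℝ) 1 := by simp
  have h1 : (1 : ℝ) ∈ Icc (0 : ℝ) 1 := by simp
  have : f ∈ kirchhoffDomain n ↔ (∀ j, f j ∈ H2) ∧ (∀ j, HasBoundaryValue (f j) 1 0) ∧
    (∃ c : ℂ, ∀ j, HasBoundaryValue (f j) 0 c) ∧
    ∃ d : Fin n → ℂ, (∀ j, HasBoundaryValue (weakDeriv (f j)) 0 (d j)) ∧ ∑ j, d j = 0 := Iff.rfl
  rw [this]
  simp only [(h _).hasBoundaryValue_iff h0, (h _).hasBoundaryValue_iff h1,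
    (h _).hasBoundaryValue_deriv_iff h0]
  constructor
  · rintro ⟨-, h2, h3, d, h4, h5⟩
    exact ⟨h2, h3, by simpa only [h4] using h5⟩
  · rintro ⟨h2, h3, h4⟩
    exact ⟨fun j => (h j).mem_H2, h2, h3, _, fun j => rfl, h4⟩

/-! ## The equation `f'' = μ f + h` on an edge -/

theorem IsH2Rep.add {f₁ g₁ f₂ g₂ : EdgeL2} {u₁ u₁' u₂ u₂' : ℝ → ℂ} (h₁ : IsH2Rep f₁ u₁ u₁' g₁)
    (h₂ : IsH2Rep f₂ u₂ u₂' g₂) :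
    IsH2Rep (f₁ + f₂) (fun t => u₁ t + u₂ t) (fun t => u₁' t + u₂' t) (g₁ + g₂) where
  ae_eq := (Lp.coeFn_add _ _).trans (h₁.ae_eq.add h₂.ae_eq)
  prim := h₁.prim.add h₂.prim
  prim' := (h₁.prim'.add h₂.prim').congr_ae (Lp.coeFn_add _ _).symm

theorem IsH2Rep.smul (c : ℂ) {f g : EdgeL2} {u u' : ℝ → ℂ} (h : IsH2Rep f u u' g) :
    IsH2Rep (c • f) (fun t => c * u t) (fun t => c * u' t) (c • g) where
  ae_eq := (Lp.coeFn_smul _ _).trans (h.ae_eq.const_smul c)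
  prim := h.prim.const_mul c
  prim' := (h.prim'.const_mul c).congr_ae (Lp.coeFn_smul c g).symm

theorem integral_norm_edge_le (h : EdgeL2) : ∫ t, ‖h t‖ ∂edgeMeasure ≤ ‖h‖ := by
  have h1 : eLpNorm h 1 edgeMeasure ≤ eLpNorm h 2 edgeMeasure := by
    have : IsProbabilityMeasure edgeMeasure := ⟨by simp⟩
    exact eLpNorm_le_eLpNorm_of_exponent_le (by norm_num) (Lp.aestronglyMeasurable h)
  rw [Lp.norm_def, integral_norm_eq_lintegral_enorm (Lp.aestronglyMeasurable h),
    ← eLpNorm_one_eq_lintegral_enorm]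
  exact ENNReal.toReal_mono (Lp.eLpNorm_ne_top h) h1

/-- The primitive of `k h` that vanishes at the outer vertex. -/
def tailInt (k : ℝ → ℂ) (h : EdgeL2) (t : ℝ) : ℂ := ∫ s in (1 : ℝ)..t, k s * h s

theorem isPrimitive_tailInt {k : ℝ → ℂ} (hk : Continuous k) (h : EdgeL2) :
    IsPrimitive (tailInt k h) (fun t => k t * h t) := by
  have hi : IntervalIntegrable (fun t => k t * h t) volume 0 1 :=
    (intervalIntegrable_iff_edge.mpr (integrable_edge h)).continuousOn_mul hk.continuousOn
  have h2 := IsPrimitive.of_integral hi (-∫ s in (0 : ℝ)..1, k s * h s)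
  refine h2.congr_eq fun t ht => ?_
  rw [tailInt, ← intervalIntegral.integral_symm, intervalIntegral.integral_add_adjacent_intervals
    hi.symm (h2.intervalIntegrable_of_mem (by simp) ht)]

theorem tailInt_one (k : ℝ → ℂ) (h : EdgeL2) : tailInt k h 1 = 0 := by simp [tailInt]

theorem tailInt_add {k : ℝ → ℂ} (hk : Continuous k) (h₁ h₂ : EdgeL2) {t : ℝ}
    (ht : t ∈ Icc (0 : ℝ) 1) : tailInt k (h₁ + h₂) t = tailInt k h₁ t + tailInt k h₂ t := by
  have h := ((isPrimitive_tailInt hk h₁).add (isPrimitive_tailInt hk h₂)).congr_ae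
    (w := fun t => k t * (h₁ + h₂ : EdgeL2) t) (by
      filter_upwards [Lp.coeFn_add h₁ h₂] with t ht
      rw [ht, Pi.add_apply]
      ring)
  refine (h.integral_eq (s := 1) (by simp) ht).trans ?_
  simp [tailInt_one]

theorem tailInt_smul {k : ℝ → ℂ} (hk : Continuous k) (c : ℂ) (h : EdgeL2) {t : ℝ}
    (ht : t ∈ Icc (0 : ℝ) 1) : tailInt k (c • h) t = c * tailInt k h t := by
  have hp := ((isPrimitive_tailInt hk h).const_mul c).congr_ae
    (w := fun t => k t * (c • h : EdgeL2) t) (by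
      filter_upwards [Lp.coeFn_smul c h] with t ht
      rw [ht, Pi.smul_apply, smul_eq_mul]
      ring)
  refine (hp.integral_eq (s := 1) (by simp) ht).trans ?_
  simp [tailInt_one]

theorem exists_bound_tailInt {k : ℝ → ℂ} (hk : Continuous k) :
    ∃ K, 0 ≤ K ∧ ∀ (h : EdgeL2), ∀ t ∈ Icc (0 : ℝ) 1, ‖tailInt k h t‖ ≤ K * ‖h‖ := by
  obtain ⟨K, hK⟩ := isCompact_Icc.exists_bound_of_continuousOn (s := Icc (0 : ℝ) 1)
    hk.continuousOn
  have hK0 : 0 ≤ K := (norm_nonneg _).trans (hK 0 (by simp))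
  refine ⟨K, hK0, fun h t ht => ?_⟩
  have hi := (isPrimitive_tailInt hk h).int
  calc ‖tailInt k h t‖ ≤ ∫ s in uIoc 1 t, ‖k s * h s‖ :=
        intervalIntegral.norm_integral_le_integral_norm_uIoc
    _ ≤ ∫ s in Ioc (0 : ℝ) 1, ‖k s * h s‖ := by
        refine setIntegral_mono_set ?_ (Eventually.of_forall fun _ => norm_nonneg _) ?_
        · exact ((intervalIntegrable_iff_integrableOn_Ioc_of_le zero_le_one).mp hi).norm
        · rw [uIoc_of_ge ht.2]
          exact (Ioc_subset_Ioc_left ht.1).eventuallyLE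
    _ = ∫ s in Ioo (0 : ℝ) 1, ‖k s * h s‖ := integral_Ioc_eq_integral_Ioo
    _ ≤ ∫ s in Ioo (0 : ℝ) 1, K * ‖h s‖ := by
        refine setIntegral_mono_on (intervalIntegrable_iff_edge.mp hi).norm
          ((integrable_edge h).norm.const_mul K) measurableSet_Ioo fun s hs => ?_
        rw [norm_mul]
        exact mul_le_mul_of_nonneg_right (hK s (Ioo_subset_Icc_self hs)) (norm_nonneg _)
    _ = K * ∫ s in Ioo (0 : ℝ) 1, ‖h s‖ := integral_const_mul _ _
    _ ≤ K * ‖h‖ := mul_le_mul_of_nonneg_left (integral_norm_edge_le h) hK0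

/-- The bounded functional `h ↦ -∫₀¹ k h`. -/
def tailIntZero (k : ℝ → ℂ) (hk : Continuous k) : EdgeL2 →L[ℂ] ℂ :=
  LinearMap.mkContinuousOfExistsBound
    { toFun := fun h => tailInt k h 0
      map_add' := fun h₁ h₂ => tailInt_add hk h₁ h₂ (by simp)
      map_smul' := fun c h => tailInt_smul hk c h (by simp) }
    (by
      obtain ⟨K, -, hK⟩ := exists_bound_tailInt hk
      exact ⟨K, fun h => hK h 0 (by simp)⟩)

@[simp]
theorem tailIntZero_apply (k : ℝ → ℂ) (hk : Continuous k) (h : EdgeL2) :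
    tailIntZero k hk h = tailInt k h 0 := rfl

/-! ### Fundamental systems and variation of constants -/

/-- The fundamental system of `f'' = μ f` with `S(0) = 0`, `S'(0) = 1`, and `C = S'`. -/
structure FundSystem (μ : ℂ) (S C : ℝ → ℂ) : Prop where
  hasDerivAt_sin : ∀ t, HasDerivAt S (C t) t
  hasDerivAt_cos : ∀ t, HasDerivAt C (μ * S t) t
  sin_zero : S 0 = 0
  cos_zero : C 0 = 1

/-- Complex `μ` is needed because the resolvent is studied before the spectrum is known to be real.
For nonzero μ = w² take sinh(wt)/w and cosh(wt); for μ = 0 take t and 1. -/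
theorem exists_fundSystem (μ : ℂ) : ∃ S C, FundSystem μ S C := by
  rcases eq_or_ne μ 0 with rfl | hμ
  · refine ⟨fun t => (t : ℂ), fun _ => 1, fun t => Complex.ofRealCLM.hasDerivAt,
      fun t => ?_, by simp, rfl⟩
    rw [zero_mul]
    exact hasDerivAt_const t _
  · obtain ⟨w, rfl⟩ := IsAlgClosed.exists_pow_nat_eq μ (n := 2) (by norm_num)
    have hw : w ≠ 0 := fun h => hμ (by simp [h])
    have hd : ∀ t : ℝ, HasDerivAt (fun t : ℝ => w * (t : ℂ)) w t := fun t => by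
      simpa using (Complex.ofRealCLM.hasDerivAt (x := t)).const_mul w
    refine ⟨fun t => Complex.sinh (w * t) / w, fun t => Complex.cosh (w * t), fun t => ?_,
      fun t => ?_, by simp, by simp⟩
    · have h := (((Complex.hasDerivAt_sinh _).comp_of_eq t (hd t) rfl).div_const w)
      simpa [hw, Function.comp_def] using h
    · have h := ((Complex.hasDerivAt_cosh _).comp_of_eq t (hd t) rfl)
      exact h.congr_deriv (by field_simp)

namespace FundSystem

variable {μ : ℂ} {S C : ℝ → ℂ}

theorem continuous_sin (hs : FundSystem μ S C) : Continuous S :=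
  continuous_iff_continuousAt.mpr fun t => (hs.hasDerivAt_sin t).continuousAt

theorem continuous_cos (hs : FundSystem μ S C) : Continuous C :=
  continuous_iff_continuousAt.mpr fun t => (hs.hasDerivAt_cos t).continuousAt

theorem isPrimitive_sin (hs : FundSystem μ S C) : IsPrimitive S C :=
  .of_hasDerivAt hs.hasDerivAt_sin hs.continuous_cos

theorem isPrimitive_cos (hs : FundSystem μ S C) : IsPrimitive C (fun t => μ * S t) :=
  .of_hasDerivAt hs.hasDerivAt_cos (hs.continuous_sin.const_mul μ)

theorem wronskian (hs : FundSystem μ S C) (t : ℝ) : C t * C t - μ * (S t * S t) = 1 := by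
  have hd : ∀ t, HasDerivAt (fun t => C t * C t - μ * (S t * S t)) 0 t := fun t => by
    have h := ((hs.hasDerivAt_cos t).mul (hs.hasDerivAt_cos t)).sub
      (((hs.hasDerivAt_sin t).mul (hs.hasDerivAt_sin t)).const_mul μ)
    exact h.congr_deriv (by ring)
  have := is_const_of_deriv_eq_zero (fun t => (hd t).differentiableAt) (fun t => (hd t).deriv) t 0
  rw [this, hs.sin_zero, hs.cos_zero]
  ring

theorem isPrimitive_sin_rev (hs : FundSystem μ S C) :
    IsPrimitive (fun t => S (1 - t)) (fun t => -C (1 - t)) :=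
  .of_hasDerivAt (fun t => by
    have h := (hs.hasDerivAt_sin (1 - t)).scomp t ((hasDerivAt_id t).const_sub 1)
    simpa [Function.comp_def] using h)
    (hs.continuous_cos.comp (continuous_const.sub continuous_id)).neg

theorem isPrimitive_cos_rev (hs : FundSystem μ S C) :
    IsPrimitive (fun t => C (1 - t)) (fun t => -(μ * S (1 - t))) :=
  .of_hasDerivAt (fun t => by
    have h := (hs.hasDerivAt_cos (1 - t)).scomp t ((hasDerivAt_id t).const_sub 1)
    simpa [Function.comp_def] using h)
    ((hs.continuous_sin.comp (continuous_const.sub continuous_id)).const_mul μ).neg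

end FundSystem

/-- The solution of `f'' = μ f + h` with `f(1) = f'(1) = 0`. -/
def partSol (S C : ℝ → ℂ) (h : EdgeL2) (t : ℝ) : ℂ := S t * tailInt C h t - C t * tailInt S h t

/-- The derivative of `partSol S C h`. -/
def partSolDeriv (μ : ℂ) (S C : ℝ → ℂ) (h : EdgeL2) (t : ℝ) : ℂ :=
  C t * tailInt C h t - μ * (S t * tailInt S h t)

namespace FundSystem

variable {μ : ℂ} {S C : ℝ → ℂ}

theorem isPrimitive_partSol (hs : FundSystem μ S C) (h : EdgeL2) :
    IsPrimitive (partSol S C h) (partSolDeriv μ S C h) := by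
  have e := (hs.isPrimitive_sin.mul (isPrimitive_tailInt hs.continuous_cos h)).sub
    (hs.isPrimitive_cos.mul (isPrimitive_tailInt hs.continuous_sin h))
  refine e.congr_ae (Eventually.of_forall fun t => ?_)
  simp only [partSolDeriv]
  ring

theorem isPrimitive_partSolDeriv (hs : FundSystem μ S C) (h : EdgeL2) :
    IsPrimitive (partSolDeriv μ S C h) (fun t => μ * partSol S C h t + h t) := by
  have e := (hs.isPrimitive_cos.mul (isPrimitive_tailInt hs.continuous_cos h)).sub
    ((hs.isPrimitive_sin.mul (isPrimitive_tailInt hs.continuous_sin h)).const_mul μ)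
  refine e.congr_ae (Eventually.of_forall fun t => ?_)
  simp only [partSol]
  linear_combination (h t) * hs.wronskian t

/-- The solution operator of `f'' = μ f + h`, `f(1) = f'(1) = 0`. -/
def solOp (hs : FundSystem μ S C) : EdgeL2 →L[ℂ] EdgeL2 :=
  LinearMap.mkContinuousOfExistsBound
    { toFun := fun h =>
        (memLp_edge_of_continuousOn (hs.isPrimitive_partSol h).continuousOn).toLp (partSol S C h)
      map_add' := fun h₁ h₂ => by
        apply Lp.ext
        filter_upwards [MemLp.coeFn_toLp
          (memLp_edge_of_continuousOn (hs.isPrimitive_partSol (h₁ + h₂)).continuousOn),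
          MemLp.coeFn_toLp (memLp_edge_of_continuousOn (hs.isPrimitive_partSol h₁).continuousOn),
          MemLp.coeFn_toLp (memLp_edge_of_continuousOn (hs.isPrimitive_partSol h₂).continuousOn),
          Lp.coeFn_add
            ((memLp_edge_of_continuousOn (hs.isPrimitive_partSol h₁).continuousOn).toLp _)
            ((memLp_edge_of_continuousOn (hs.isPrimitive_partSol h₂).continuousOn).toLp _),
          ae_restrict_mem measurableSet_Ioo] with t e1 e2 e3 e4 ht
        have ht' := Ioo_subset_Icc_self ht
        rw [e1, e4, Pi.add_apply, e2, e3, partSol, tailInt_add hs.continuous_cos _ _ ht',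
          tailInt_add hs.continuous_sin _ _ ht', partSol, partSol]
        ring
      map_smul' := fun c h => by
        apply Lp.ext
        filter_upwards [MemLp.coeFn_toLp
          (memLp_edge_of_continuousOn (hs.isPrimitive_partSol (c • h)).continuousOn),
          MemLp.coeFn_toLp (memLp_edge_of_continuousOn (hs.isPrimitive_partSol h).continuousOn),
          Lp.coeFn_smul c
            ((memLp_edge_of_continuousOn (hs.isPrimitive_partSol h).continuousOn).toLp _),
          ae_restrict_mem measurableSet_Ioo] with t e1 e2 e3 ht
        have ht' := Ioo_subset_Icc_self ht
        rw [e1, RingHom.id_apply, e3, Pi.smul_apply, e2, partSol,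
          tailInt_smul hs.continuous_cos _ _ ht', tailInt_smul hs.continuous_sin _ _ ht', partSol,
          smul_eq_mul]
        ring }
    (by
      obtain ⟨K, hK0, hK⟩ := exists_bound_tailInt hs.continuous_sin
      obtain ⟨L, hL0, hL⟩ := exists_bound_tailInt hs.continuous_cos
      obtain ⟨M, hM⟩ := isCompact_Icc.exists_bound_of_continuousOn (s := Icc (0 : ℝ) 1)
        hs.continuous_sin.continuousOn
      obtain ⟨N, hN⟩ := isCompact_Icc.exists_bound_of_continuousOn (s := Icc (0 : ℝ) 1)
        hs.continuous_cos.continuousOn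
      have hM0 : 0 ≤ M := (norm_nonneg _).trans (hM 0 (by simp))
      have hN0 : 0 ≤ N := (norm_nonneg _).trans (hN 0 (by simp))
      -- `M`, `N` bound `S`, `C` and `L`, `K` bound the tail integrals. The edge has measure one, so
      -- a uniform bound also bounds the L² norm.
      refine ⟨M * L + N * K, fun h => ?_⟩
      have : IsProbabilityMeasure edgeMeasure := ⟨by simp⟩
      refine (Lp.norm_le_of_ae_bound (C := (M * L + N * K) * ‖h‖) (by positivity) ?_).trans
        (by simp [measureUnivNNReal])
      filter_upwards [MemLp.coeFn_toLp
          (memLp_edge_of_continuousOn (hs.isPrimitive_partSol h).continuousOn),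
          ae_restrict_mem measurableSet_Ioo] with t e1 ht
      have ht' := Ioo_subset_Icc_self ht
      simp only [LinearMap.coe_mk, AddHom.coe_mk]
      rw [e1, partSol]
      refine (norm_sub_le _ _).trans ?_
      rw [norm_mul, norm_mul, add_mul, mul_assoc, mul_assoc]
      exact add_le_add (mul_le_mul (hM t ht') (hL h t ht') (norm_nonneg _) hM0)
        (mul_le_mul (hN t ht') (hK h t ht') (norm_nonneg _) hN0))

theorem coeFn_solOp (hs : FundSystem μ S C) (h : EdgeL2) :
    hs.solOp h =ᵐ[edgeMeasure] partSol S C h :=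
  MemLp.coeFn_toLp (memLp_edge_of_continuousOn (hs.isPrimitive_partSol h).continuousOn)

theorem isH2Rep_solOp (hs : FundSystem μ S C) (h : EdgeL2) :
    IsH2Rep (hs.solOp h) (partSol S C h) (partSolDeriv μ S C h) (μ • hs.solOp h + h) where
  ae_eq := hs.coeFn_solOp h
  prim := hs.isPrimitive_partSol h
  prim' := (hs.isPrimitive_partSolDeriv h).congr_ae (by
    filter_upwards [Lp.coeFn_add (μ • hs.solOp h) h, Lp.coeFn_smul μ (hs.solOp h),
      hs.coeFn_solOp h] with t e1 e2 e3
    rw [e1, Pi.add_apply, e2, Pi.smul_apply, e3, smul_eq_mul])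

/-- The solution of `f'' = μ f` with `f(1) = 0`, `f'(1) = -1`. -/
def homSol (hs : FundSystem μ S C) : EdgeL2 :=
  (memLp_edge_of_continuousOn hs.isPrimitive_sin_rev.continuousOn).toLp (fun t => S (1 - t))

theorem coeFn_homSol (hs : FundSystem μ S C) :
    hs.homSol =ᵐ[edgeMeasure] fun t => S (1 - t) :=
  MemLp.coeFn_toLp _

theorem isH2Rep_homSol (hs : FundSystem μ S C) :
    IsH2Rep hs.homSol (fun t => S (1 - t)) (fun t => -C (1 - t)) (μ • hs.homSol) where
  ae_eq := hs.coeFn_homSol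
  prim := hs.isPrimitive_sin_rev
  prim' := (hs.isPrimitive_cos_rev.const_mul (-1)).congr_eq (fun t _ => by ring) |>.congr_ae (by
    filter_upwards [Lp.coeFn_smul μ hs.homSol, hs.coeFn_homSol] with t e1 e2
    rw [e1, Pi.smul_apply, e2, smul_eq_mul]
    ring)

/-- Its derivative at the outer vertex is -1. -/
theorem homSol_ne_zero (hs : FundSystem μ S C) : hs.homSol ≠ 0 := by
  intro h0
  have h1 : IsH2Rep 0 (fun t => S (1 - t)) (fun t => -C (1 - t)) 0 := by
    have h2 := hs.isH2Rep_homSol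
    rwa [h0, smul_zero] at h2
  have hd : HasBoundaryValue (weakDeriv 0) 1 0 := by
    rw [weakDeriv_zero]
    exact .zero 1
  have := (h1.hasBoundaryValue_deriv_iff (by simp)).mp hd
  simp [hs.cos_zero] at this

theorem isH2Rep_solOp_add (hs : FundSystem μ S C) (h : EdgeL2) (a : ℂ) :
    IsH2Rep (hs.solOp h + a • hs.homSol) (fun t => partSol S C h t + a * S (1 - t))
      (fun t => partSolDeriv μ S C h t + a * -C (1 - t))
      (μ • (hs.solOp h + a • hs.homSol) + h) := by
  have e := (hs.isH2Rep_solOp h).add (hs.isH2Rep_homSol.smul a)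
  convert e using 1
  rw [smul_add, smul_comm μ a]
  abel

/-- The quantities u C(1 - t) + u' S(1 - t) and u' C(1 - t) + μ u S(1 - t) are constant, equal to 0
and u'(1) by their values at t = 1. This is a linear system for u and u' whose determinant is 1 by
the Wronskian identity. -/
theorem eq_of_homogeneous (hs : FundSystem μ S C) {u u' : ℝ → ℂ} (h : IsPrimitive u u')
    (h' : IsPrimitive u' (fun t => μ * u t)) (h1 : u 1 = 0) {t : ℝ} (ht : t ∈ Icc (0 : ℝ) 1) :
    u t = -u' 1 * S (1 - t) := by
  have p := ((h.mul hs.isPrimitive_cos_rev).add (h'.mul hs.isPrimitive_sin_rev)).eq_of_deriv_zero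
    (fun t => by ring) ht (show (1 : ℝ) ∈ Icc (0 : ℝ) 1 by simp)
  have q := ((h'.mul hs.isPrimitive_cos_rev).add
    ((h.mul hs.isPrimitive_sin_rev).const_mul μ)).eq_of_deriv_zero
    (fun t => by ring) ht (show (1 : ℝ) ∈ Icc (0 : ℝ) 1 by simp)
  simp only [h1, sub_self, hs.sin_zero, hs.cos_zero] at p q
  linear_combination C (1 - t) * p - S (1 - t) * q - u t * hs.wronskian (1 - t)

/-- Subtracting the particular solution leaves a solution of the homogeneous equation that vanishes
at 1; the coefficient is minus its derivative there. -/
theorem exists_eq_solOp_add (hs : FundSystem μ S C) {f h : EdgeL2} {u u' : ℝ → ℂ}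
    (hf : IsH2Rep f u u' (μ • f + h)) (h1 : u 1 = 0) :
    ∃ a : ℂ, f = hs.solOp h + a • hs.homSol := by
  have hp := hs.isH2Rep_solOp h
  have d := hf.add (hp.smul (-1))
  have d' := d.prim'.congr_ae (w := fun t => μ * (u t + -1 * partSol S C h t)) (by
    have e : (μ • f + h + (-1 : ℂ) • (μ • hs.solOp h + h)) = μ • (f + (-1 : ℂ) • hs.solOp h) := by
      module
    rw [e]
    filter_upwards [Lp.coeFn_smul μ (f + (-1 : ℂ) • hs.solOp h), d.ae_eq] with t e1 e2
    rw [e1, Pi.smul_apply, e2, smul_eq_mul])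
  refine ⟨-(u' 1 + -1 * partSolDeriv μ S C h 1), ?_⟩
  have key := fun {t : ℝ} (ht : t ∈ Icc (0 : ℝ) 1) => hs.eq_of_homogeneous d.prim d'
    (by simp [h1, partSol, tailInt_one]) ht
  apply Lp.ext
  filter_upwards [hf.ae_eq, (hs.isH2Rep_solOp_add h
    (-(u' 1 + -1 * partSolDeriv μ S C h 1))).ae_eq, ae_restrict_mem measurableSet_Ioo]
    with t e1 e2 ht
  rw [e1, e2]
  linear_combination key (Ioo_subset_Icc_self ht)

end FundSystem

open UnboundedOperator

/-! ## Resolvent and eigenspaces of the indefinite Kirchhoff Laplacian -/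

theorem edgeSign_mul_self (np nm : ℕ) (j : Fin (np + nm)) :
    edgeSign np nm j * edgeSign np nm j = 1 := by
  unfold edgeSign
  split_ifs <;> norm_num

theorem shift_indefiniteKirchhoff_apply {np nm : ℕ} (z : ℂ)
    (x : (indefiniteKirchhoff np nm).domain) (j : Fin (np + nm)) :
    shift (indefiniteKirchhoff np nm) z x j =
      -(edgeSign np nm j • weakDeriv (weakDeriv ((x : GraphL2 (np + nm)) j))) -
        z • (x : GraphL2 (np + nm)) j := rfl

/-- The linear system for the coefficients `a` of the homogeneous solutions on the edges and the
common value `c` at the central vertex. -/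
def vertexMap {n : ℕ} (S C : Fin n → ℝ → ℂ) : (Fin n → ℂ) × ℂ →ₗ[ℂ] (Fin n → ℂ) × ℂ where
  toFun p := (fun j => p.2 - p.1 j * S j 1, ∑ j, p.1 j * C j 1)
  map_add' p q := by
    ext
    · simp
      ring
    · simp [add_mul, Finset.sum_add_distrib]
  map_smul' c p := by
    ext
    · simp
      ring
    · simp [mul_assoc, Finset.mul_sum]

section

variable {np nm : ℕ} {z : ℂ} {S C : Fin (np + nm) → ℝ → ℂ}

/-- The boundary data at the central vertex of the particular solution. -/
def vertexData (hs : ∀ j, FundSystem (-(edgeSign np nm j * z)) (S j) (C j)) :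
    GraphL2 (np + nm) →L[ℂ] (Fin (np + nm) → ℂ) × ℂ :=
  (ContinuousLinearMap.pi fun j => edgeSign np nm j •
    (tailIntZero (S j) (hs j).continuous_sin ∘L PiLp.proj 2 (fun _ => EdgeL2) j)).prod
  (∑ j, -edgeSign np nm j •
    (tailIntZero (C j) (hs j).continuous_cos ∘L PiLp.proj 2 (fun _ => EdgeL2) j))

/-- The particular solution of `(B - z) f = g`, ignoring the conditions at the central vertex. -/
def graphSolOp (hs : ∀ j, FundSystem (-(edgeSign np nm j * z)) (S j) (C j)) :
    GraphL2 (np + nm) →L[ℂ] GraphL2 (np + nm) :=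
  (PiLp.continuousLinearEquiv 2 ℂ (fun _ : Fin (np + nm) => EdgeL2)).symm.toContinuousLinearMap ∘L
    ContinuousLinearMap.pi fun j => -edgeSign np nm j •
      ((hs j).solOp ∘L PiLp.proj 2 (fun _ => EdgeL2) j)

/-- The homogeneous solution with the coefficients `a`. -/
def graphHomSol (hs : ∀ j, FundSystem (-(edgeSign np nm j * z)) (S j) (C j)) :
    (Fin (np + nm) → ℂ) →ₗ[ℂ] GraphL2 (np + nm) where
  toFun a := WithLp.toLp 2 fun j => a j • (hs j).homSol
  map_add' a b := by
    ext1 j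
    simp [add_smul]
  map_smul' c a := by
    ext1 j
    simp [mul_smul]

theorem graphHomSol_injective
    (hs : ∀ j, FundSystem (-(edgeSign np nm j * z)) (S j) (C j)) :
    Function.Injective (graphHomSol hs) := by
  refine (injective_iff_map_eq_zero _).mpr fun a ha => ?_
  ext j
  have h : a j • (hs j).homSol = 0 := congrArg (fun f : GraphL2 (np + nm) => f j) ha
  exact (smul_eq_zero.mp h).resolve_right (hs j).homSol_ne_zero

/-- As the signs square to one, (B - z) f = g becomes f'' = μ f + h with μ = -εz and h = -εg.
Solving it from the outer vertices leaves one coefficient per edge; continuity with value `p.2` and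
the Kirchhoff condition at 0 are then the linear system for `p`. -/
theorem shift_eq_iff (hs : ∀ j, FundSystem (-(edgeSign np nm j * z)) (S j) (C j))
    (f g : GraphL2 (np + nm)) :
    (∃ x : (indefiniteKirchhoff np nm).domain, (x : GraphL2 (np + nm)) = f ∧
      shift (indefiniteKirchhoff np nm) z x = g) ↔
    ∃ p, f = graphSolOp hs g + graphHomSol hs p.1 ∧ vertexMap S C p = vertexData hs g := by
  have hsol : ∀ j, graphSolOp hs g j = (hs j).solOp (-edgeSign np nm j • g j) := fun j =>
    (map_smul (hs j).solOp _ _).symm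
  have hd1 : ∀ j, (vertexData hs g).1 j = partSol (S j) (C j) (-edgeSign np nm j • g j) 0 := by
    intro j
    have : (vertexData hs g).1 j = edgeSign np nm j * tailInt (S j) (g j) 0 := rfl
    rw [this, partSol, tailInt_smul (hs j).continuous_cos _ _ (by simp),
      tailInt_smul (hs j).continuous_sin _ _ (by simp), (hs j).sin_zero, (hs j).cos_zero]
    ring
  have hd2 : (vertexData hs g).2 = ∑ j, partSolDeriv (-(edgeSign np nm j * z)) (S j) (C j)
      (-edgeSign np nm j • g j) 0 := by
    have : (vertexData hs g).2 = ∑ j, -edgeSign np nm j * tailInt (C j) (g j) 0 := by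
      simp [vertexData]
    rw [this]
    refine Finset.sum_congr rfl fun j _ => ?_
    rw [partSolDeriv, tailInt_smul (hs j).continuous_cos _ _ (by simp),
      tailInt_smul (hs j).continuous_sin _ _ (by simp), (hs j).sin_zero, (hs j).cos_zero]
    ring
  have hrep : ∀ (a : Fin (np + nm) → ℂ) (j), IsH2Rep ((graphSolOp hs g + graphHomSol hs a) j)
      (fun t => partSol (S j) (C j) (-edgeSign np nm j • g j) t + a j * S j (1 - t))
      (fun t => partSolDeriv (-(edgeSign np nm j * z)) (S j) (C j) (-edgeSign np nm j • g j) t +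
        a j * -C j (1 - t))
      (-(edgeSign np nm j * z) • (graphSolOp hs g + graphHomSol hs a) j +
        -edgeSign np nm j • g j) := by
    intro a j
    have h := (hs j).isH2Rep_solOp_add (-edgeSign np nm j • g j) (a j)
    rwa [← hsol j] at h
  have hmem : ∀ a : Fin (np + nm) → ℂ, graphSolOp hs g + graphHomSol hs a ∈
      kirchhoffDomain (np + nm) ↔ ∃ c, vertexMap S C (a, c) = vertexData hs g := by
    intro a
    rw [mem_kirchhoffDomain_iff (g := WithLp.toLp 2 fun j =>
      (-(edgeSign np nm j * z) • (graphSolOp hs g + graphHomSol hs a) j +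
        -edgeSign np nm j • g j)) (hrep a)]
    simp only [sub_self, sub_zero, (hs _).sin_zero, mul_zero, add_zero, Prod.ext_iff, funext_iff,
      hd1, hd2]
    have e1 : ∀ j, partSol (S j) (C j) (-edgeSign np nm j • g j) 1 = 0 := fun j => by
      simp [partSol, tailInt_one]
    simp only [e1, implies_true, true_and, vertexMap, LinearMap.coe_mk, AddHom.coe_mk,
      Finset.sum_add_distrib, mul_neg, Finset.sum_neg_distrib, exists_and_right]
    refine and_congr (exists_congr fun c => forall_congr' fun j => ?_) ?_
    · rw [sub_eq_iff_eq_add, eq_comm]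
    · rw [← sub_eq_add_neg, sub_eq_zero, eq_comm]
  constructor
  · rintro ⟨x, rfl, hx⟩
    have hx2 : ∀ j, (x : GraphL2 (np + nm)) j ∈ H2 := x.2.1
    choose u u' hu using fun j => exists_isH2Rep (hx2 j)
    have hu1 : ∀ j, u j 1 = 0 := fun j =>
      ((hu j).hasBoundaryValue_iff (by simp)).mp (x.2.2.1 j)
    have hw : ∀ j, weakDeriv (weakDeriv ((x : GraphL2 (np + nm)) j)) =
        -(edgeSign np nm j * z) • (x : GraphL2 (np + nm)) j + -edgeSign np nm j • g j := by
      intro j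
      have h := congrArg (fun f : GraphL2 (np + nm) => f j) hx
      simp only [shift_indefiniteKirchhoff_apply] at h
      have e : weakDeriv (weakDeriv ((x : GraphL2 (np + nm)) j)) =
        (edgeSign np nm j * edgeSign np nm j) •
          weakDeriv (weakDeriv ((x : GraphL2 (np + nm)) j)) := by
        rw [edgeSign_mul_self, one_smul]
      rw [e, ← h]
      module
    have ha : ∀ j, ∃ a : ℂ, (x : GraphL2 (np + nm)) j =
        (hs j).solOp (-edgeSign np nm j • g j) + a • (hs j).homSol := by
      intro j
      have h := hu j
      rw [hw j] at h
      exact (hs j).exists_eq_solOp_add h (hu1 j)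
    choose a ha using ha
    have hxa : (x : GraphL2 (np + nm)) = graphSolOp hs g + graphHomSol hs a := by
      ext1 j
      rw [ha j, PiLp.add_apply, hsol j]
      rfl
    have hxm : (x : GraphL2 (np + nm)) ∈ kirchhoffDomain (np + nm) := x.2
    rw [hxa, hmem] at hxm
    obtain ⟨c, hc⟩ := hxm
    exact ⟨(a, c), hxa, hc⟩
  · rintro ⟨p, hf, hp⟩
    have hm := (hmem p.1).mpr ⟨p.2, hp⟩
    rw [← hf] at hm
    refine ⟨⟨f, hm⟩, rfl, ?_⟩
    ext1 j
    rw [shift_indefiniteKirchhoff_apply]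
    have e := (hrep p.1 j).weakDeriv_weakDeriv
    rw [← hf] at e
    simp only [e]
    have e2 : g j = (edgeSign np nm j * edgeSign np nm j) • g j := by
      rw [edgeSign_mul_self, one_smul]
    have e3 : z • f j = (edgeSign np nm j * edgeSign np nm j) • z • f j := by
      rw [edgeSign_mul_self, one_smul]
    rw [e3]
    nth_rewrite 2 [e2]
    module

/-- Solvability depends on `g` only through finitely many bounded functionals, which makes the range
closed for every `z`. -/
theorem range_shift_eq (hs : ∀ j, FundSystem (-(edgeSign np nm j * z)) (S j) (C j)) :
    (LinearMap.range (shift (indefiniteKirchhoff np nm) z) : Set (GraphL2 (np + nm))) =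
      vertexData hs ⁻¹' (LinearMap.range (vertexMap S C) : Set ((Fin (np + nm) → ℂ) × ℂ)) := by
  ext g
  constructor
  · rintro ⟨x, hx⟩
    obtain ⟨p, -, hp⟩ := (shift_eq_iff hs x g).mp ⟨x, rfl, hx⟩
    exact ⟨p, hp⟩
  · rintro ⟨p, hp⟩
    obtain ⟨x, -, hx⟩ := (shift_eq_iff hs _ g).mpr ⟨p, rfl, hp⟩
    exact ⟨x, hx⟩

theorem isClosed_range_shift (np nm : ℕ) (z : ℂ) :
    IsClosed (LinearMap.range (shift (indefiniteKirchhoff np nm) z) :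
      Set (GraphL2 (np + nm))) := by
  choose S C hs using fun j : Fin (np + nm) => exists_fundSystem (-(edgeSign np nm j * z))
  rw [range_shift_eq hs]
  exact (Submodule.closed_of_finiteDimensional _).preimage (vertexData hs).continuous

theorem mem_eigenspace_iff {H : Type*} [NormedAddCommGroup H] [InnerProductSpace ℂ H]
    {T : H →ₗ.[ℂ] H} {z : ℂ} {f : H} :
    f ∈ eigenspace T z ↔ ∃ x : T.domain, (x : H) = f ∧ shift T z x = 0 := by
  simp only [eigenspace, Submodule.mem_map, LinearMap.mem_ker, Submodule.subtype_apply]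
  exact exists_congr fun x => and_comm

theorem mem_eigenspace_indefiniteKirchhoff_iff
    (hs : ∀ j, FundSystem (-(edgeSign np nm j * z)) (S j) (C j)) {f : GraphL2 (np + nm)} :
    f ∈ eigenspace (indefiniteKirchhoff np nm) z ↔
      ∃ p, f = graphHomSol hs p.1 ∧ vertexMap S C p = 0 := by
  rw [mem_eigenspace_iff, shift_eq_iff hs f 0]
  simp only [map_zero, zero_add]

theorem rank_eigenspace_eq (hs : ∀ j, FundSystem (-(edgeSign np nm j * z)) (S j) (C j))
    (hn : 1 ≤ np + nm) : Module.rank ℂ (eigenspace (indefiniteKirchhoff np nm) z) =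
      Module.rank ℂ (LinearMap.ker (vertexMap S C)) := by
  let F : LinearMap.ker (vertexMap S C) →ₗ[ℂ] GraphL2 (np + nm) :=
    (graphHomSol hs ∘ₗ LinearMap.fst ℂ _ _).domRestrict _
  have hF : Function.Injective F := by
    refine (injective_iff_map_eq_zero _).mpr ?_
    rintro ⟨⟨a, c⟩, hp⟩ ha
    have ha0 : a = 0 := graphHomSol_injective hs (by rw [map_zero]; exact ha)
    -- With all coefficients zero, the equation of a single edge gives `c = 0`; this uses that there
    -- is an edge.
    have hc := congrFun (congrArg Prod.fst (LinearMap.mem_ker.mp hp)) ⟨0, hn⟩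
    simp only [vertexMap, LinearMap.coe_mk, AddHom.coe_mk, ha0, Pi.zero_apply, zero_mul, sub_zero,
      Prod.fst_zero] at hc
    simp [ha0, hc]
  have hrange : LinearMap.range F = eigenspace (indefiniteKirchhoff np nm) z := by
    ext f
    rw [mem_eigenspace_indefiniteKirchhoff_iff hs]
    constructor
    · rintro ⟨p, rfl⟩
      exact ⟨p, rfl, p.2⟩
    · rintro ⟨p, rfl, hp⟩
      exact ⟨⟨p, hp⟩, rfl⟩
  rw [← hrange]
  exact (LinearEquiv.ofInjective F hF).symm.rank_eq

/-- The vertex system is square, so a trivial kernel makes it invertible. The resolvent is the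
particular solution plus a correction that depends linearly on finite-dimensional data, and so it is
bounded. -/
theorem mem_resolventSet_of_eigenspace_eq_bot (hn : 1 ≤ np + nm)
    (h : eigenspace (indefiniteKirchhoff np nm) z = ⊥) :
    z ∈ resolventSet (indefiniteKirchhoff np nm) := by
  choose S C hs using fun j : Fin (np + nm) => exists_fundSystem (-(edgeSign np nm j * z))
  have hker : LinearMap.ker (vertexMap S C) = ⊥ := by
    rw [← Submodule.rank_eq_zero, ← rank_eigenspace_eq hs hn, h, rank_bot]
  let A := LinearEquiv.ofInjectiveEndo (vertexMap S C) (LinearMap.ker_eq_bot.mp hker)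
  let R : GraphL2 (np + nm) →L[ℂ] GraphL2 (np + nm) := graphSolOp hs +
    (LinearMap.toContinuousLinearMap
      (graphHomSol hs ∘ₗ LinearMap.fst ℂ _ _ ∘ₗ A.symm.toLinearMap)) ∘L vertexData hs
  have hR : ∀ (x : (indefiniteKirchhoff np nm).domain) (y : GraphL2 (np + nm)),
      shift (indefiniteKirchhoff np nm) z x = y → R y = x := by
    intro x y hx
    obtain ⟨p, hxp, hp⟩ := (shift_eq_iff hs x y).mp ⟨x, rfl, hx⟩
    have hp' : A.symm (vertexData hs y) = p := by
      rw [LinearEquiv.symm_apply_eq, ← hp]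
      rfl
    rw [hxp, ← hp']
    rfl
  refine ⟨R, fun x => hR x _ rfl, fun y => ?_⟩
  obtain ⟨x, -, hx⟩ := (shift_eq_iff hs _ y).mpr ⟨A.symm (vertexData hs y), rfl,
    A.apply_symm_apply _⟩
  exact ⟨x, (hR x y hx).symm, hx⟩

end

theorem eigenspace_eq_bot_of_mem_resolventSet {H : Type*} [NormedAddCommGroup H]
    [InnerProductSpace ℂ H] {T : H →ₗ.[ℂ] H} {z : ℂ} (hz : z ∈ resolventSet T) :
    eigenspace T z = ⊥ := by
  obtain ⟨R, hR, -⟩ := hz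
  rw [eq_bot_iff]
  intro f hf
  obtain ⟨x, rfl, hx⟩ := mem_eigenspace_iff.mp hf
  rw [Submodule.mem_bot, ← hR x, hx, map_zero]

theorem opSpectrum_eq_pointSpectrum {np nm : ℕ} (hn : 1 ≤ np + nm) :
    opSpectrum (indefiniteKirchhoff np nm) = pointSpectrum (indefiniteKirchhoff np nm) := by
  ext z
  exact not_congr ⟨eigenspace_eq_bot_of_mem_resolventSet, mem_resolventSet_of_eigenspace_eq_bot hn⟩

section

/-! ## Positivity in the Krein space -/

theorem kreinForm_eq_sum_inner (np nm : ℕ) (f g : GraphL2 (np + nm)) :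
    kreinForm np nm f g = ∑ j, edgeSign np nm j * inner ℂ (g j) (f j) := by
  refine Finset.sum_congr rfl fun j _ => ?_
  rw [L2.inner_def]
  rfl

theorem conj_edgeSign (np nm : ℕ) (j : Fin (np + nm)) :
    conj (edgeSign np nm j) = edgeSign np nm j := by
  unfold edgeSign
  split_ifs <;> simp

theorem conj_kreinForm {np nm : ℕ} (f g : GraphL2 (np + nm)) :
    conj (kreinForm np nm f g) = kreinForm np nm g f := by
  simp only [kreinForm_eq_sum_inner, map_sum, map_mul, conj_edgeSign, inner_conj_symm]

theorem kreinForm_sub_left {np nm : ℕ} (f g h : GraphL2 (np + nm)) :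
    kreinForm np nm (f - g) h = kreinForm np nm f h - kreinForm np nm g h := by
  simp only [kreinForm_eq_sum_inner, PiLp.sub_apply, inner_sub_right, mul_sub,
    Finset.sum_sub_distrib]

theorem kreinForm_smul_left {np nm : ℕ} (c : ℂ) (f g : GraphL2 (np + nm)) :
    kreinForm np nm (c • f) g = c * kreinForm np nm f g := by
  simp only [kreinForm_eq_sum_inner, PiLp.smul_apply, inner_smul_right, Finset.mul_sum,
    mul_left_comm]

theorem kreinForm_zero_left {np nm : ℕ} (g : GraphL2 (np + nm)) : kreinForm np nm 0 g = 0 := by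
  simp [kreinForm_eq_sum_inner]

variable {np nm : ℕ}

/-- Integration by parts: `[B f, g] = ∑ ∫ f' conj g'`. -/
theorem kreinForm_apply_eq (x y : (indefiniteKirchhoff np nm).domain)
    {u u' v v' : Fin (np + nm) → ℝ → ℂ} {f g : Fin (np + nm) → EdgeL2}
    (hu : ∀ j, IsH2Rep ((x : GraphL2 (np + nm)) j) (u j) (u' j) (f j))
    (hv : ∀ j, IsH2Rep ((y : GraphL2 (np + nm)) j) (v j) (v' j) (g j)) :
    kreinForm np nm (indefiniteKirchhoff np nm x) y =
      ∑ j, ∫ t in Ioo (0 : ℝ) 1, u' j t * conj (v' j t) := by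
  obtain ⟨-, -, hx⟩ := (mem_kirchhoffDomain_iff (g := WithLp.toLp 2 f) hu).mp x.2
  obtain ⟨hy1, ⟨c, hy0⟩, -⟩ := (mem_kirchhoffDomain_iff (g := WithLp.toLp 2 g) hv).mp y.2
  -- The two signs multiply to one. The boundary term vanishes at 1, and at 0 it contains the same
  -- factor `conj c` on every edge, so the Kirchhoff condition removes the sum.
  have key : ∀ j, edgeSign np nm j * ∫ t in Ioo (0 : ℝ) 1,
      indefiniteKirchhoff np nm x j t * conj ((y : GraphL2 (np + nm)) j t) =
      (∫ t in Ioo (0 : ℝ) 1, u' j t * conj (v' j t)) + u' j 0 * conj c := by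
    intro j
    have hm := ((hu j).prim'.mul (hv j).prim.star).integral_Ioo
    have hI : uIcc (0 : ℝ) 1 = Icc 0 1 := uIcc_of_le zero_le_one
    rw [integral_add] at hm
    rotate_left
    · exact intervalIntegrable_iff_edge.mp ((hu j).prim'.int.mul_continuousOn
        (by rw [hI]; exact (hv j).prim.star.continuousOn))
    · exact intervalIntegrable_iff_edge.mp ((hv j).prim.star.int.continuousOn_mul
        (by rw [hI]; exact (hu j).prim'.continuousOn))
    rw [hy1 j, hy0 j, map_zero, mul_zero, zero_sub] at hm
    have hB : indefiniteKirchhoff np nm x j = -(edgeSign np nm j • f j) := by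
      rw [← (hu j).weakDeriv_weakDeriv]
      rfl
    have e : ∫ t in Ioo (0 : ℝ) 1,
        indefiniteKirchhoff np nm x j t * conj ((y : GraphL2 (np + nm)) j t) =
        ∫ t in Ioo (0 : ℝ) 1, -edgeSign np nm j * (f j t * conj (v j t)) := by
      refine integral_congr_ae ?_
      rw [hB]
      filter_upwards [Lp.coeFn_neg (edgeSign np nm j • f j), Lp.coeFn_smul (edgeSign np nm j) (f j),
        (hv j).ae_eq] with t e1 e2 e3
      rw [e1, Pi.neg_apply, e2, Pi.smul_apply, e3, smul_eq_mul]
      ring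
    rw [e, integral_const_mul]
    linear_combination (-∫ t in Ioo (0 : ℝ) 1, f j t * conj (v j t)) * edgeSign_mul_self np nm j - hm
  rw [kreinForm, Finset.sum_congr rfl fun j _ => key j, Finset.sum_add_distrib, ← Finset.sum_mul,
    hx, zero_mul, add_zero]

theorem kreinForm_apply_symm (x y : (indefiniteKirchhoff np nm).domain) :
    kreinForm np nm (indefiniteKirchhoff np nm x) y =
      conj (kreinForm np nm (indefiniteKirchhoff np nm y) x) := by
  choose u u' hu using fun j => exists_isH2Rep (x.2.1 j)
  choose v v' hv using fun j => exists_isH2Rep (y.2.1 j)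
  rw [kreinForm_apply_eq x y hu hv, kreinForm_apply_eq y x hv hu, map_sum]
  refine Finset.sum_congr rfl fun j _ => ?_
  rw [← integral_conj]
  refine integral_congr_ae (Eventually.of_forall fun t => ?_)
  simp [mul_comm]

/-- The form is the sum of the integrals of |u'|². If it vanishes, each u is constant, and the outer
vertices make it zero. -/
theorem kreinForm_apply_self_pos (x : (indefiniteKirchhoff np nm).domain)
    (hx : (x : GraphL2 (np + nm)) ≠ 0) :
    0 < (kreinForm np nm (indefiniteKirchhoff np nm x) x).re ∧
      (kreinForm np nm (indefiniteKirchhoff np nm x) x).im = 0 := by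
  choose u u' hu using fun j => exists_isH2Rep (x.2.1 j)
  have hx1 : ∀ j, u j 1 = 0 := ((mem_kirchhoffDomain_iff (g := WithLp.toLp 2 fun j =>
    weakDeriv (weakDeriv ((x : GraphL2 (np + nm)) j))) hu).mp x.2).1
  have e : kreinForm np nm (indefiniteKirchhoff np nm x) x =
      ((∑ j, ∫ t in Ioo (0 : ℝ) 1, ‖u' j t‖ ^ 2 : ℝ) : ℂ) := by
    rw [kreinForm_apply_eq x x hu hu, Complex.ofReal_sum]
    refine Finset.sum_congr rfl fun j _ => ?_
    rw [← integral_complex_ofReal]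
    refine integral_congr_ae (Eventually.of_forall fun t => ?_)
    simp [Complex.mul_conj, Complex.normSq_eq_norm_sq]
  rw [e]
  refine ⟨?_, Complex.ofReal_im _⟩
  rw [Complex.ofReal_re]
  have hnn : ∀ j, 0 ≤ ∫ t in Ioo (0 : ℝ) 1, ‖u' j t‖ ^ 2 := fun j =>
    integral_nonneg fun t => by positivity
  refine lt_of_le_of_ne (Finset.sum_nonneg fun j _ => hnn j) fun h0 => hx ?_
  ext1 j
  have hj := (Finset.sum_eq_zero_iff_of_nonneg fun j _ => hnn j).mp h0.symm j (Finset.mem_univ j)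
  have hc := (hu j).prim'.continuousOn
  have hint : Integrable (fun t => ‖u' j t‖ ^ 2) edgeMeasure := by
    have := ((hc.norm.pow 2).integrableOn_Icc (μ := volume)).mono_set Ioo_subset_Icc_self
    exact this
  have hae := (integral_eq_zero_iff_of_nonneg (fun t => by positivity) hint).mp hj
  have h0' : EqOn (u' j) 0 (Icc 0 1) := eqOn_of_ae_eq_edge hc continuousOn_const (by
    filter_upwards [hae] with t ht
    simpa using ht)
  apply Lp.ext
  filter_upwards [(hu j).ae_eq, Lp.coeFn_zero ℂ 2 edgeMeasure,
    ae_restrict_mem measurableSet_Ioo] with t e1 e2 ht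
  have ht' := Ioo_subset_Icc_self ht
  have hz : IsPrimitive (u j) (fun _ => 0) := (hu j).prim.congr_ae (by
    filter_upwards [ae_restrict_mem measurableSet_Ioo] with s hs
    exact h0' (Ioo_subset_Icc_self hs))
  rw [e1, hz.eq_of_deriv_zero (fun _ => rfl) ht' (show (1 : ℝ) ∈ Icc (0 : ℝ) 1 by simp), hx1 j]
  exact e2.symm

theorem eq_zero_of_kreinForm_apply_self {x : (indefiniteKirchhoff np nm).domain}
    (hx : kreinForm np nm (indefiniteKirchhoff np nm x) x = 0) : (x : GraphL2 (np + nm)) = 0 := by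
  by_contra h
  have := (kreinForm_apply_self_pos x h).1
  rw [hx] at this
  exact lt_irrefl _ this

theorem shift_apply {H : Type*} [NormedAddCommGroup H] [InnerProductSpace ℂ H]
    (T : H →ₗ.[ℂ] H) (z : ℂ) (x : T.domain) : shift T z x = T x - z • (x : H) := rfl

theorem zero_mem_resolventSet (hn : 1 ≤ np + nm) :
    (0 : ℂ) ∈ resolventSet (indefiniteKirchhoff np nm) := by
  refine mem_resolventSet_of_eigenspace_eq_bot hn ?_
  rw [eq_bot_iff]
  intro f hf
  obtain ⟨x, rfl, hx⟩ := mem_eigenspace_iff.mp hf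
  rw [shift_apply, zero_smul, sub_zero] at hx
  exact eq_zero_of_kreinForm_apply_self (by rw [hx, kreinForm_zero_left])

/-- For g orthogonal to the domain, solve B x = Jg, where J multiplies each edge by its sign; this
is possible since 0 is in the resolvent set. Then [Bx, x] is the Hilbert inner product of g with x,
which is zero, so x = 0 and g = 0. -/
theorem dense_domain (hn : 1 ≤ np + nm) :
    Dense ((indefiniteKirchhoff np nm).domain : Set (GraphL2 (np + nm))) := by
  rw [Submodule.dense_iff_topologicalClosure_eq_top, Submodule.topologicalClosure_eq_top_iff,
    eq_bot_iff]
  intro g hg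
  rw [Submodule.mem_orthogonal] at hg
  obtain ⟨R, -, hR⟩ := zero_mem_resolventSet (np := np) (nm := nm) hn
  obtain ⟨x, -, hx⟩ := hR (WithLp.toLp 2 fun j => edgeSign np nm j • g j)
  rw [shift_apply, zero_smul, sub_zero] at hx
  have h1 := hg x x.2
  rw [PiLp.inner_apply] at h1
  have h2 : (x : GraphL2 (np + nm)) = 0 := by
    refine eq_zero_of_kreinForm_apply_self ?_
    rw [hx, kreinForm_eq_sum_inner, ← h1]
    refine Finset.sum_congr rfl fun j _ => ?_
    simp only [inner_smul_right, ← mul_assoc, edgeSign_mul_self, one_mul]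
  have h3 : x = 0 := Subtype.ext h2
  rw [h3, LinearPMap.map_zero] at hx
  rw [Submodule.mem_bot]
  ext1 j
  have h4 : (0 : EdgeL2) = edgeSign np nm j • g j :=
    congrArg (fun f : GraphL2 (np + nm) => f j) hx
  have h5 : g j = (edgeSign np nm j * edgeSign np nm j) • g j := by
    rw [edgeSign_mul_self, one_smul]
  rw [h5, mul_smul, ← h4, smul_zero]
  rfl

theorem isKreinPositive_indefiniteKirchhoff (hn : 1 ≤ np + nm) :
    IsKreinPositive np nm (indefiniteKirchhoff np nm) :=
  ⟨dense_domain hn, kreinForm_apply_self_pos⟩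

/-- For an eigenvector, z [x, x] = [Bx, x] is positive while [x, x] is real. -/
theorem im_eq_zero_of_mem_pointSpectrum {z : ℂ}
    (hz : z ∈ pointSpectrum (indefiniteKirchhoff np nm)) : z.im = 0 := by
  obtain ⟨f, hf, hf0⟩ := (Submodule.ne_bot_iff _).mp hz
  obtain ⟨x, rfl, hx⟩ := mem_eigenspace_iff.mp hf
  rw [shift_apply, sub_eq_zero] at hx
  have h1 := kreinForm_apply_self_pos x hf0
  rw [hx, kreinForm_smul_left] at h1
  have h2 : (kreinForm np nm (x : GraphL2 (np + nm)) x).im = 0 :=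
    Complex.conj_eq_iff_im.mp (conj_kreinForm _ _)
  rw [Complex.mul_re, Complex.mul_im, h2, mul_zero, mul_zero, zero_add, sub_zero] at h1
  exact (mul_eq_zero.mp h1.2).resolve_right fun h => by simp [h] at h1

/-- If y = (B - z) x is in the eigenspace and nonzero, then z is real and symmetry gives [y, y] = 0.
Hence [By, y] = z [y, y] = 0, which contradicts positivity. -/
theorem shift_eq_zero_of_mem_eigenspace {z : ℂ} {x : (indefiniteKirchhoff np nm).domain}
    (hx : shift (indefiniteKirchhoff np nm) z x ∈ eigenspace (indefiniteKirchhoff np nm) z) :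
    shift (indefiniteKirchhoff np nm) z x = 0 := by
  by_contra hne
  have hz : conj z = z := Complex.conj_eq_iff_im.mpr (im_eq_zero_of_mem_pointSpectrum
    ((Submodule.ne_bot_iff _).mpr ⟨_, hx, hne⟩))
  obtain ⟨y, hy, hy0⟩ := mem_eigenspace_iff.mp hx
  rw [shift_apply, sub_eq_zero] at hy0
  have h1 : kreinForm np nm (y : GraphL2 (np + nm)) y = 0 := by
    nth_rewrite 1 [hy]
    rw [shift_apply, kreinForm_sub_left, kreinForm_apply_symm, hy0, kreinForm_smul_left,
      kreinForm_smul_left, map_mul, conj_kreinForm, hz, sub_self]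
  apply hne
  rw [← hy]
  exact eq_zero_of_kreinForm_apply_self (by rw [hy0, kreinForm_smul_left, h1, mul_zero])

theorem rootSubspace_eq_eigenspace (z : ℂ) :
    rootSubspace (indefiniteKirchhoff np nm) z = eigenspace (indefiniteKirchhoff np nm) z := by
  have h : ∀ m, kerPow (indefiniteKirchhoff np nm) z (m + 1) =
      eigenspace (indefiniteKirchhoff np nm) z := by
    intro m
    induction m with
    | zero => rfl
    | succ m ih =>
      rw [kerPow, ih, eigenspace]
      congr 1
      ext x
      rw [Submodule.mem_comap, LinearMap.mem_ker]
      exact ⟨shift_eq_zero_of_mem_eigenspace, fun hx => by rw [hx]; exact Submodule.zero_mem _⟩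
  refine le_antisymm (iSup_le fun m => ?_) ((h 0).symm.le.trans (le_iSup _ 1))
  cases m with
  | zero => exact bot_le
  | succ m => exact (h m).le

end

section

/-! ## Dimension of the eigenspaces -/

theorem vertexMap_eq_zero_iff {n : ℕ} {S C : Fin n → ℝ → ℂ} {p : (Fin n → ℂ) × ℂ} :
    vertexMap S C p = 0 ↔ (∀ j, p.1 j * S j 1 = p.2) ∧ ∑ j, p.1 j * C j 1 = 0 := by
  simp only [vertexMap, LinearMap.coe_mk, AddHom.coe_mk, Prod.ext_iff, funext_iff, Prod.fst_zero,
    Prod.snd_zero, Pi.zero_apply, sub_eq_zero, eq_comm (a := p.2)]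

/-- The vertex value c determines the coefficients c / S_j(1), and the Kirchhoff condition leaves c
free exactly when the sum of the quotients vanishes. -/
theorem rank_ker_vertexMap_of_ne {n : ℕ} {S C : Fin n → ℝ → ℂ} (hS : ∀ j, S j 1 ≠ 0) :
    Module.rank ℂ (LinearMap.ker (vertexMap S C)) =
      ((if ∑ j, C j 1 / S j 1 = 0 then 1 else 0 : ℕ) : Cardinal) := by
  have hc : ∀ p, vertexMap S C p = 0 →
      p.1 = (fun j => p.2 / S j 1) ∧ p.2 * ∑ j, C j 1 / S j 1 = 0 := by
    intro p hp
    obtain ⟨h1, h2⟩ := vertexMap_eq_zero_iff.mp hp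
    have h3 : p.1 = fun j => p.2 / S j 1 := funext fun j => by rw [eq_div_iff (hS j), h1 j]
    refine ⟨h3, ?_⟩
    rw [h3] at h2
    rw [← h2, Finset.mul_sum]
    exact Finset.sum_congr rfl fun j _ => by ring
  split_ifs with h
  · have hv : LinearMap.ker (vertexMap S C) =
        Submodule.span ℂ {((fun j => 1 / S j 1, 1) : (Fin n → ℂ) × ℂ)} := by
      ext p
      rw [LinearMap.mem_ker, Submodule.mem_span_singleton]
      constructor
      · intro hp
        refine ⟨p.2, ?_⟩
        ext j
        · rw [(hc p hp).1]
          simp [div_eq_mul_inv]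
        · simp
      · rintro ⟨a, rfl⟩
        rw [map_smul, vertexMap_eq_zero_iff.mpr, smul_zero]
        refine ⟨fun j => one_div_mul_cancel (hS j), ?_⟩
        rw [← h]
        exact Finset.sum_congr rfl fun j _ => by ring
    rw [hv, ← Module.finrank_eq_rank, finrank_span_singleton (by simp)]
  · have hv : LinearMap.ker (vertexMap S C) = ⊥ := by
      rw [eq_bot_iff]
      intro p hp
      obtain ⟨h1, h2⟩ := hc p hp
      have h3 := (mul_eq_zero.mp h2).resolve_right h
      rw [Submodule.mem_bot]
      ext j
      · rw [h1, h3]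
        simp
      · exact h3
    rw [hv, rank_bot, Nat.cast_zero]

/-- One edge with S(1) = 0 forces the vertex value to vanish, and with it the coefficients where
S(1) ≠ 0. The others are subject only to having sum zero, because C(1) has the common nonzero value
`κ` there. -/
theorem rank_ker_vertexMap_of_eq {n : ℕ} {S C : Fin n → ℝ → ℂ} {p : Fin n → Prop}
    [DecidablePred p] {κ : ℂ} (hκ : κ ≠ 0) (hp : ∀ j, p j → S j 1 = 0 ∧ C j 1 = κ)
    (hp' : ∀ j, ¬ p j → S j 1 ≠ 0) (h0 : ∃ j, p j) :
    Module.rank ℂ (LinearMap.ker (vertexMap S C)) =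
      ((Fintype.card {j // p j} - 1 : ℕ) : Cardinal) := by
  let F : ({j // p j} → ℂ) →ₗ[ℂ] (Fin n → ℂ) × ℂ :=
    { toFun := fun a => (fun j => if h : p j then a ⟨j, h⟩ else 0, 0)
      map_add' := fun a b => by
        ext j
        · by_cases h : p j <;> simp [h]
        · simp
      map_smul' := fun c a => by
        ext j
        · by_cases h : p j <;> simp [h]
        · simp }
  have hF1 : ∀ a j, (F a).1 j = if h : p j then a ⟨j, h⟩ else 0 := fun _ _ => rfl
  have hF2 : ∀ a, (F a).2 = 0 := fun _ => rfl
  have hF : Function.Injective F := by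
    intro a b hab
    ext ⟨j, hj⟩
    have := congrFun (congrArg Prod.fst hab) j
    simpa [hF1, hj] using this
  let σ : ({j // p j} → ℂ) →ₗ[ℂ] ℂ := ∑ j, LinearMap.proj j
  have hσ : ∀ a, σ a = ∑ j, a j := fun a => by simp [σ]
  have hsum : ∀ a, ∑ j, (F a).1 j * C j 1 = σ a * κ := by
    intro a
    rw [hσ, Finset.sum_mul]
    symm
    refine Fintype.sum_of_injective Subtype.val Subtype.val_injective _ _ ?_ ?_
    · intro j hj
      have : ¬ p j := fun h => hj ⟨⟨j, h⟩, rfl⟩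
      simp [hF1, this]
    · rintro ⟨j, hj⟩
      simp [hF1, hj, (hp j hj).2]
  have hker : LinearMap.ker (vertexMap S C) = (LinearMap.ker σ).map F := by
    ext q
    rw [LinearMap.mem_ker, vertexMap_eq_zero_iff, Submodule.mem_map]
    constructor
    · rintro ⟨hq1, hq2⟩
      obtain ⟨j₀, hj₀⟩ := h0
      have hc : q.2 = 0 := by rw [← hq1 j₀, (hp j₀ hj₀).1, mul_zero]
      have hq : q = F fun j => q.1 j := by
        ext j
        · rw [hF1]
          split_ifs with h
          · rfl
          · have := hq1 j
            rw [hc] at this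
            exact (mul_eq_zero.mp this).resolve_right (hp' j h)
        · exact hc
      refine ⟨fun j => q.1 j, ?_, hq.symm⟩
      rw [hq, hsum] at hq2
      exact (mul_eq_zero.mp hq2).resolve_right hκ
    · rintro ⟨a, ha, rfl⟩
      refine ⟨fun j => ?_, ?_⟩
      · rw [hF1, hF2]
        split_ifs with h
        · rw [(hp j h).1, mul_zero]
        · rw [zero_mul]
      · rw [hsum, LinearMap.mem_ker.mp ha, zero_mul]
  rw [hker, ← (Submodule.equivMapOfInjective F hF (LinearMap.ker σ)).rank_eq,
    ← Module.finrank_eq_rank]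
  congr 1
  have hsurj : Function.Surjective σ := by
    obtain ⟨j₀, hj₀⟩ := h0
    intro c
    refine ⟨Pi.single ⟨j₀, hj₀⟩ c, ?_⟩
    rw [hσ, Finset.sum_pi_single']
    simp
  have hrn := LinearMap.finrank_range_add_finrank_ker σ
  rw [LinearMap.range_eq_top.mpr hsurj, finrank_top, Module.finrank_self,
    Module.finrank_fintype_fun_eq_card] at hrn
  omega

/-! ### Real fundamental systems and the multiplicity formula -/

theorem fundSystem_trig {s : ℝ} (hs : s ≠ 0) : FundSystem (-((s ^ 2 : ℝ) : ℂ))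
    (fun t => ((Real.sin (s * t) / s : ℝ) : ℂ)) (fun t => ((Real.cos (s * t) : ℝ) : ℂ)) where
  hasDerivAt_sin t := by
    have hd : HasDerivAt (fun t => s * t) s t := by simpa using (hasDerivAt_id t).const_mul s
    exact ((hd.sin.div_const s).congr_deriv (by field_simp)).ofReal_comp
  hasDerivAt_cos t := by
    have hd : HasDerivAt (fun t => s * t) s t := by simpa using (hasDerivAt_id t).const_mul s
    have h := (hd.cos.congr_deriv
      (show _ = -(s ^ 2) * (Real.sin (s * t) / s) by field_simp)).ofReal_comp
    exact h.congr_deriv (by push_cast; rfl)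
  sin_zero := by simp
  cos_zero := by simp

theorem fundSystem_hyp {s : ℝ} (hs : s ≠ 0) : FundSystem ((s ^ 2 : ℝ) : ℂ)
    (fun t => ((Real.sinh (s * t) / s : ℝ) : ℂ)) (fun t => ((Real.cosh (s * t) : ℝ) : ℂ)) where
  hasDerivAt_sin t := by
    have hd : HasDerivAt (fun t => s * t) s t := by simpa using (hasDerivAt_id t).const_mul s
    exact ((hd.sinh.div_const s).congr_deriv (by field_simp)).ofReal_comp
  hasDerivAt_cos t := by
    have hd : HasDerivAt (fun t => s * t) s t := by simpa using (hasDerivAt_id t).const_mul s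
    have h := (hd.cosh.congr_deriv
      (show _ = s ^ 2 * (Real.sinh (s * t) / s) by field_simp)).ofReal_comp
    exact h.congr_deriv (by push_cast; rfl)
  sin_zero := by simp
  cos_zero := by simp

section

variable {np nm N M : ℕ} {s : ℝ} {z : ℂ} {p : Fin (np + nm) → Prop} [DecidablePred p]

/-- The rank of the eigenspace when the solutions are trigonometric on the `N` edges that satisfy
`p`, and hyperbolic on the other `M` edges. -/
theorem rank_eigenspace_of_pred (hs : 0 < s)
    (hp : ∀ j, p j → edgeSign np nm j * z = ((s ^ 2 : ℝ) : ℂ))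
    (hp' : ∀ j, ¬ p j → edgeSign np nm j * z = -((s ^ 2 : ℝ) : ℂ))
    (hN : Fintype.card {j // p j} = N) (hM : Fintype.card {j // ¬ p j} = M) (hN0 : 1 ≤ N) :
    Module.rank ℂ (eigenspace (indefiniteKirchhoff np nm) z) =
      ((if Real.sin s = 0 then N - 1 else
        if N * (Real.cos s * Real.sinh s) + M * (Real.cosh s * Real.sin s) = 0 then 1 else 0 : ℕ) :
          Cardinal) := by
  let S : Fin (np + nm) → ℝ → ℂ := fun j => if p j then fun t => ((Real.sin (s * t) / s : ℝ) : ℂ)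
    else fun t => ((Real.sinh (s * t) / s : ℝ) : ℂ)
  let C : Fin (np + nm) → ℝ → ℂ := fun j => if p j then fun t => ((Real.cos (s * t) : ℝ) : ℂ)
    else fun t => ((Real.cosh (s * t) : ℝ) : ℂ)
  have hfs : ∀ j, FundSystem (-(edgeSign np nm j * z)) (S j) (C j) := by
    intro j
    by_cases h : p j
    · simp only [S, C, if_pos h, hp j h]
      exact fundSystem_trig hs.ne'
    · simp only [S, C, if_neg h, hp' j h, neg_neg]
      exact fundSystem_hyp hs.ne'
  have hsinh : 0 < Real.sinh s := Real.sinh_pos_iff.mpr hs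
  have hSp : ∀ j, p j → S j 1 = ((Real.sin s / s : ℝ) : ℂ) := fun j h => by simp [S, h]
  have hSn : ∀ j, ¬ p j → S j 1 = ((Real.sinh s / s : ℝ) : ℂ) := fun j h => by simp [S, h]
  have hCp : ∀ j, p j → C j 1 = ((Real.cos s : ℝ) : ℂ) := fun j h => by simp [C, h]
  have hCn : ∀ j, ¬ p j → C j 1 = ((Real.cosh s : ℝ) : ℂ) := fun j h => by simp [C, h]
  have hSn0 : ∀ j, ¬ p j → S j 1 ≠ 0 := fun j h => by
    rw [hSn j h]
    exact Complex.ofReal_ne_zero.mpr (by positivity)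
  have hjN : ∃ j, p j := by
    have : Nonempty {j // p j} := Fintype.card_pos_iff.mp (by omega)
    exact ⟨this.some.1, this.some.2⟩
  rw [rank_eigenspace_eq hfs (Fin.pos hjN.choose)]
  by_cases h : Real.sin s = 0
  · have hcos : Real.cos s ≠ 0 := fun h' => by
      have := Real.sin_sq_add_cos_sq s
      rw [h, h'] at this
      norm_num at this
    rw [if_pos h, ← hN]
    exact rank_ker_vertexMap_of_eq (Complex.ofReal_ne_zero.mpr hcos)
      (fun j hj => ⟨by rw [hSp j hj, h]; simp, hCp j hj⟩) hSn0 hjN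
  · rw [if_neg h, rank_ker_vertexMap_of_ne (fun j => by
      by_cases hj : p j
      · rw [hSp j hj]
        exact Complex.ofReal_ne_zero.mpr (div_ne_zero h hs.ne')
      · exact hSn0 j hj)]
    have e : ∑ j, C j 1 / S j 1 = ((N * (Real.cos s / (Real.sin s / s)) +
        M * (Real.cosh s / (Real.sinh s / s)) : ℝ) : ℂ) := by
      have : ∀ j, C j 1 / S j 1 = if p j then ((Real.cos s / (Real.sin s / s) : ℝ) : ℂ) else
          ((Real.cosh s / (Real.sinh s / s) : ℝ) : ℂ) := by
        intro j
        split_ifs with hj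
        · rw [hSp j hj, hCp j hj, Complex.ofReal_div (Real.cos s)]
        · rw [hSn j hj, hCn j hj, Complex.ofReal_div (Real.cosh s)]
      rw [Finset.sum_congr rfl fun j _ => this j, Finset.sum_ite, Finset.sum_const,
        Finset.sum_const, ← Fintype.card_subtype, ← Fintype.card_subtype, hN, hM]
      push_cast
      simp only [nsmul_eq_mul]
    rw [e]
    -- Clearing denominators: the common factor s / (sin s sinh s) is nonzero.
    have e2 : N * (Real.cos s / (Real.sin s / s)) + M * (Real.cosh s / (Real.sinh s / s)) =
        (N * (Real.cos s * Real.sinh s) + M * (Real.cosh s * Real.sin s)) *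
          (s / (Real.sin s * Real.sinh s)) := by
      field_simp
    simp only [Complex.ofReal_eq_zero, e2, mul_eq_zero (b := s / _),
      or_iff_left (div_ne_zero hs.ne' (mul_ne_zero h hsinh.ne'))]

end

/-- The dimension of the eigenspace at `s ^ 2` for `N` positive and `M` negative edges. -/
def eigenDim (N M : ℕ) (s : ℝ) : ℕ :=
  if Real.sin s = 0 then N - 1 else
    if N * (Real.cos s * Real.sinh s) + M * (Real.cosh s * Real.sin s) = 0 then 1 else 0

variable {np nm : ℕ}

theorem card_pos_edges (np nm : ℕ) : Fintype.card {j : Fin (np + nm) // (j : ℕ) < np} = np := by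
  rw [Fintype.card_subtype]
  simp [Fin.card_filter_val_lt]

theorem card_neg_edges (np nm : ℕ) :
    Fintype.card {j : Fin (np + nm) // ¬ (j : ℕ) < np} = nm := by
  rw [Fintype.card_subtype_compl, card_pos_edges, Fintype.card_fin]
  omega

theorem hasMultiplicity_of_rank {z : ℂ} {m : ℕ}
    (h : Module.rank ℂ (eigenspace (indefiniteKirchhoff np nm) z) = m) :
    HasMultiplicity (indefiniteKirchhoff np nm) z m :=
  ⟨h, by rw [rootSubspace_eq_eigenspace, h]⟩

theorem hasMultiplicity_sq (hnp : 1 ≤ np) {s : ℝ} (hs : 0 < s) :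
    HasMultiplicity (indefiniteKirchhoff np nm) ((s ^ 2 : ℝ) : ℂ) (eigenDim np nm s) :=
  hasMultiplicity_of_rank <| rank_eigenspace_of_pred (p := fun j => (j : ℕ) < np) hs
    (fun j hj => by rw [edgeSign, if_pos hj, one_mul])
    (fun j hj => by rw [edgeSign, if_neg hj, neg_one_mul])
    (card_pos_edges np nm) (card_neg_edges np nm) hnp

/-- At a negative number the solutions are trigonometric on the negative edges, so the two edge
counts change places. -/
theorem hasMultiplicity_neg_sq (hnm : 1 ≤ nm) {s : ℝ} (hs : 0 < s) :
    HasMultiplicity (indefiniteKirchhoff np nm) ((-s ^ 2 : ℝ) : ℂ) (eigenDim nm np s) :=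
  hasMultiplicity_of_rank <| rank_eigenspace_of_pred (p := fun j => ¬ (j : ℕ) < np) hs
    (fun j hj => by rw [edgeSign, if_neg hj]; push_cast; ring)
    (fun j hj => by rw [edgeSign, if_pos (not_not.mp hj)]; push_cast; ring)
    (card_neg_edges np nm) (by simpa only [not_not] using card_pos_edges np nm) hnm

theorem mem_opSpectrum_iff (hn : 1 ≤ np + nm) {z : ℂ} {m : ℕ}
    (h : HasMultiplicity (indefiniteKirchhoff np nm) z m) :
    z ∈ opSpectrum (indefiniteKirchhoff np nm) ↔ m ≠ 0 := by
  rw [opSpectrum_eq_pointSpectrum hn]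
  have : z ∈ pointSpectrum (indefiniteKirchhoff np nm) ↔
    eigenspace (indefiniteKirchhoff np nm) z ≠ ⊥ := Iff.rfl
  rw [this, ← Submodule.rank_eq_zero.ne, h.1, Nat.cast_ne_zero]

theorem exists_eq_sq_of_mem_opSpectrum (hn : 1 ≤ np + nm) {z : ℂ}
    (hz : z ∈ opSpectrum (indefiniteKirchhoff np nm)) :
    ∃ s : ℝ, 0 < s ∧ (z = ((s ^ 2 : ℝ) : ℂ) ∨ z = ((-s ^ 2 : ℝ) : ℂ)) := by
  have hre : z = (z.re : ℂ) := by
    have := im_eq_zero_of_mem_pointSpectrum (by rwa [← opSpectrum_eq_pointSpectrum hn])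
    exact Complex.ext rfl (by simp [this])
  have h0 : z.re ≠ 0 := by
    intro h
    rw [h, Complex.ofReal_zero] at hre
    rw [hre] at hz
    exact hz (zero_mem_resolventSet hn)
  rcases lt_or_gt_of_ne h0 with h | h
  · refine ⟨Real.sqrt (-z.re), Real.sqrt_pos.mpr (by linarith), Or.inr ?_⟩
    rw [Real.sq_sqrt (by linarith), neg_neg, ← hre]
  · refine ⟨Real.sqrt z.re, Real.sqrt_pos.mpr h, Or.inl ?_⟩
    rw [Real.sq_sqrt h.le, ← hre]

end

/-! ## The transcendental equation -/

theorem _root_.Real.strictMono_tanh : StrictMono Real.tanh := by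
  intro x y h
  rw [← sub_pos]
  have e : Real.tanh y - Real.tanh x = Real.sinh (y - x) / (Real.cosh y * Real.cosh x) := by
    rw [Real.tanh_eq_sinh_div_cosh, Real.tanh_eq_sinh_div_cosh, Real.sinh_sub]
    field_simp
  rw [e]
  exact div_pos (Real.sinh_pos_iff.mpr (sub_pos.mpr h))
    (mul_pos (Real.cosh_pos _) (Real.cosh_pos _))

theorem _root_.Real.continuous_tanh : Continuous Real.tanh := by
  have : Real.tanh = fun x => Real.sinh x / Real.cosh x := funext Real.tanh_eq_sinh_div_cosh
  rw [this]
  exact Real.continuous_sinh.div Real.continuous_cosh fun x => (Real.cosh_pos x).ne'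

theorem _root_.Real.arctan_sub_arctan_le {x y : ℝ} (h : x ≤ y) :
    Real.arctan y - Real.arctan x ≤ y - x := by
  have hm : Monotone fun t => t - Real.arctan t := by
    have hd : ∀ t, HasDerivAt (fun t => t - Real.arctan t) (1 - 1 / (1 + t ^ 2)) t := fun t =>
      (hasDerivAt_id t).sub (Real.hasDerivAt_arctan t)
    refine monotone_of_deriv_nonneg (fun t => (hd t).differentiableAt) fun t => ?_
    rw [(hd t).deriv, sub_nonneg, div_le_one (by positivity)]
    nlinarith [sq_nonneg t]
  have := hm h
  simp only at this
  linarith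

theorem _root_.Real.one_sub_tanh_le (x : ℝ) : 1 - Real.tanh x ≤ 2 * Real.exp (-(2 * x)) := by
  have h : Real.exp x ≤ 2 * Real.cosh x := by
    rw [Real.cosh_eq]
    linarith [Real.exp_pos (-x)]
  have h2 : 1 - Real.tanh x = Real.exp (-x) / Real.cosh x := by
    rw [Real.tanh_eq_sinh_div_cosh, ← Real.cosh_sub_sinh]
    field_simp
  rw [h2, div_le_iff₀ (Real.cosh_pos x)]
  calc Real.exp (-x) = Real.exp (-(2 * x)) * Real.exp x := by rw [← Real.exp_add]; ring_nf
    _ ≤ Real.exp (-(2 * x)) * (2 * Real.cosh x) := by gcongr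
    _ = _ := by ring

/-- The phase of the secular equation. -/
def phase (r x : ℝ) : ℝ := x + Real.arctan (r * Real.tanh x)

theorem strictMono_phase {r : ℝ} (hr : 0 < r) : StrictMono (phase r) := fun _ _ h =>
  add_lt_add h (Real.arctan_strictMono (mul_lt_mul_of_pos_left (Real.strictMono_tanh h) hr))

theorem continuous_phase (r : ℝ) : Continuous (phase r) :=
  continuous_id.add (Real.continuous_arctan.comp (Real.continuous_tanh.const_mul r))

theorem tanh_pos {x : ℝ} (hx : 0 < x) : 0 < Real.tanh x := by
  have := Real.strictMono_tanh hx
  rwa [Real.tanh_zero] at this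

/-- The arctangent term lies strictly between 0 and π/2 for positive x, so the phase is below kπ at
(k - 1)π and above it at kπ. -/
theorem exists_phase_eq {r : ℝ} (hr : 0 < r) {k : ℤ} (hk : 1 ≤ k) :
    ∃ x ∈ Ioo (((k : ℝ) - 1) * Real.pi) (k * Real.pi), phase r x = k * Real.pi := by
  have hk' : (1 : ℝ) ≤ k := by exact_mod_cast hk
  have hpi := Real.pi_pos
  have h1 : phase r (((k : ℝ) - 1) * Real.pi) < k * Real.pi := by
    have := Real.arctan_lt_pi_div_two (r * Real.tanh (((k : ℝ) - 1) * Real.pi))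
    unfold phase
    linarith
  have h2 : (k : ℝ) * Real.pi < phase r (k * Real.pi) := by
    have := Real.arctan_pos.mpr (mul_pos hr (tanh_pos (show 0 < (k : ℝ) * Real.pi by positivity)))
    unfold phase
    linarith
  have hle : ((k : ℝ) - 1) * Real.pi ≤ k * Real.pi := by nlinarith
  obtain ⟨x, hx, hx'⟩ := intermediate_value_Ioo hle (continuous_phase r).continuousOn
    (show (k : ℝ) * Real.pi ∈ _ from ⟨h1, h2⟩)
  exact ⟨x, hx, hx'⟩

/-- The `k`-th positive solution `x` of `coth x = -r cot x`. -/
def secularRoot (r : ℝ) (k : ℤ) : ℝ :=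
  Function.invFun (phase r) (k * Real.pi)

/-- The phase is injective on the whole line, so the value chosen by `Function.invFun` is the only
solution. -/
theorem phase_eq_iff {r : ℝ} (hr : 0 < r) {k : ℤ} (hk : 1 ≤ k) {x : ℝ} :
    phase r x = k * Real.pi ↔ x = secularRoot r k := by
  obtain ⟨y, -, hy⟩ := exists_phase_eq hr hk
  have h : phase r (secularRoot r k) = k * Real.pi := Function.invFun_eq ⟨y, hy⟩
  rw [← h]
  exact (strictMono_phase hr).injective.eq_iff

theorem secularRoot_mem {r : ℝ} (hr : 0 < r) {k : ℤ} (hk : 1 ≤ k) :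
    secularRoot r k ∈ Ioo (((k : ℝ) - 1) * Real.pi) (k * Real.pi) := by
  obtain ⟨y, hy, hy'⟩ := exists_phase_eq hr hk
  rwa [← (phase_eq_iff hr hk).mp hy']

theorem secularRoot_pos {r : ℝ} (hr : 0 < r) {k : ℤ} (hk : 1 ≤ k) : 0 < secularRoot r k := by
  have hk' : (1 : ℝ) ≤ k := by exact_mod_cast hk
  exact lt_of_le_of_lt (mul_nonneg (by linarith) Real.pi_pos.le) (secularRoot_mem hr hk).1

theorem phase_secularRoot {r : ℝ} (hr : 0 < r) {k : ℤ} (hk : 1 ≤ k) :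
    phase r (secularRoot r k) = k * Real.pi := (phase_eq_iff hr hk).mpr rfl

theorem sin_ne_zero_of_mem {k : ℤ} {x : ℝ} (hx : x ∈ Ioo (((k : ℝ) - 1) * Real.pi) (k * Real.pi)) :
    Real.sin x ≠ 0 := by
  intro h
  obtain ⟨m, hm⟩ := Real.sin_eq_zero_iff.mp h
  rw [← hm] at hx
  have h1 : (k : ℝ) - 1 < m := lt_of_mul_lt_mul_right hx.1 Real.pi_pos.le
  have h2 : (m : ℝ) < k := lt_of_mul_lt_mul_right hx.2 Real.pi_pos.le
  have h3 : k - 1 < m := by exact_mod_cast h1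
  have h4 : m < k := by exact_mod_cast h2
  omega

/-- The secular equation in terms of the phase. -/
theorem secular_iff_phase {r : ℝ} (hr : 0 < r) {k : ℤ} {x : ℝ} (h0 : 0 < x)
    (hx : x ∈ Ioo (((k : ℝ) - 1) * Real.pi) (k * Real.pi)) :
    r * (Real.cos x * Real.sinh x) + Real.cosh x * Real.sin x = 0 ↔ phase r x = k * Real.pi := by
  -- In terms of θ, which lies in (0, π), the equation is sin θ = r tanh x cos θ, independently of
  -- the parity of `k`.
  set θ := k * Real.pi - x with hθ
  have hθ0 : 0 < θ := by have := hx.2; simp only [hθ]; linarith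
  have hθ1 : θ < Real.pi := by have := hx.1; simp only [hθ]; linarith
  have hsin : 0 < Real.sin θ := Real.sin_pos_of_pos_of_lt_pi hθ0 hθ1
  have hsinh : 0 < Real.sinh x := Real.sinh_pos_iff.mpr h0
  have hcosh := Real.cosh_pos x
  have hx' : x = k * Real.pi - θ := by simp only [hθ]; ring
  have e1 : Real.sin x = -((-1) ^ k * Real.sin θ) := by
    rw [hx']
    exact Real.sin_int_mul_pi_sub θ k
  have e2 : Real.cos x = (-1) ^ k * Real.cos θ := by
    rw [hx']
    exact Real.cos_int_mul_pi_sub θ k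
  have hone : ((-1 : ℝ) ^ k) ≠ 0 := zpow_ne_zero _ (by norm_num)
  have h1 : r * (Real.cos x * Real.sinh x) + Real.cosh x * Real.sin x = 0 ↔
      Real.sin θ = r * Real.tanh x * Real.cos θ := by
    have e3 : r * (Real.cos x * Real.sinh x) + Real.cosh x * Real.sin x =
        ((-1) ^ k * Real.cosh x) * (r * Real.tanh x * Real.cos θ - Real.sin θ) := by
      rw [e1, e2, Real.tanh_eq_sinh_div_cosh]
      field_simp
      ring
    rw [e3, mul_eq_zero, or_iff_right (mul_ne_zero hone hcosh.ne'), sub_eq_zero, eq_comm]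
  have h2 : phase r x = k * Real.pi ↔ θ = Real.arctan (r * Real.tanh x) := by
    unfold phase
    simp only [hθ]
    constructor <;> intro h <;> linarith
  rw [h1, h2]
  have ht := tanh_pos h0
  constructor
  · intro h
    -- Since sin θ > 0, the equation forces cos θ > 0, so θ is in the range where the arctangent
    -- inverts the tangent.
    have hcos : 0 < Real.cos θ := by
      by_contra hc
      have : r * Real.tanh x * Real.cos θ ≤ 0 :=
        mul_nonpos_of_nonneg_of_nonpos (by positivity) (not_lt.mp hc)
      linarith
    have hlt : θ < Real.pi / 2 := by
      by_contra hc
      have := Real.cos_nonpos_of_pi_div_two_le_of_le (not_lt.mp hc) (by linarith)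
      linarith
    have htan : Real.tan θ = r * Real.tanh x := by
      rw [Real.tan_eq_sin_div_cos, h]
      field_simp
    rw [← htan, Real.arctan_tan (by linarith) hlt]
  · intro h
    have hcos : 0 < Real.cos θ := by rw [h]; exact Real.cos_arctan_pos _
    have htan : Real.tan θ = r * Real.tanh x := by rw [h, Real.tan_arctan]
    rw [Real.tan_eq_sin_div_cos, div_eq_iff hcos.ne'] at htan
    exact htan

theorem coth_eq_iff {r x : ℝ} (h0 : 0 < x) (hs : Real.sin x ≠ 0) :
    coth x = -r * Real.cot x ↔
      r * (Real.cos x * Real.sinh x) + Real.cosh x * Real.sin x = 0 := by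
  have hsinh : 0 < Real.sinh x := Real.sinh_pos_iff.mpr h0
  rw [coth, Real.cot_eq_cos_div_sin, ← mul_div_assoc, div_eq_div_iff hsinh.ne' hs]
  constructor <;> intro h <;> linarith

theorem coth_eq_iff_secularRoot {r : ℝ} (hr : 0 < r) {k : ℤ} (hk : 1 ≤ k) {x : ℝ} (h0 : 0 < x)
    (hx : x ∈ Ioo (((k : ℝ) - 1) * Real.pi) (k * Real.pi)) :
    coth x = -r * Real.cot x ↔ x = secularRoot r k := by
  rw [coth_eq_iff h0 (sin_ne_zero_of_mem hx), secular_iff_phase hr h0 hx, phase_eq_iff hr hk]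

theorem exists_mem_Ioo_of_sin_ne_zero {x : ℝ} (h0 : 0 < x) (hs : Real.sin x ≠ 0) :
    ∃ k : ℤ, 1 ≤ k ∧ x ∈ Ioo (((k : ℝ) - 1) * Real.pi) (k * Real.pi) := by
  have hpi := Real.pi_pos
  refine ⟨⌊x / Real.pi⌋ + 1, ?_, ?_, ?_⟩
  · have : 0 ≤ ⌊x / Real.pi⌋ := Int.floor_nonneg.mpr (by positivity)
    omega
  · push_cast
    rw [add_sub_cancel_right]
    refine lt_of_le_of_ne ((le_div_iff₀ hpi).mp (Int.floor_le _)) fun h => hs ?_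
    rw [← h, Real.sin_int_mul_pi]
  · push_cast
    exact (div_lt_iff₀ hpi).mp (Int.lt_floor_add_one _)

theorem exists_eq_nat_mul_pi {x : ℝ} (h0 : 0 < x) (hs : Real.sin x = 0) :
    ∃ k : ℕ, 1 ≤ k ∧ x = k * Real.pi := by
  obtain ⟨m, hm⟩ := Real.sin_eq_zero_iff.mp hs
  have h1 : (0 : ℝ) < m := by
    rw [← hm] at h0
    exact pos_of_mul_pos_left h0 Real.pi_pos.le
  have h2 : 0 < m := by exact_mod_cast h1
  lift m to ℕ using h2.le
  exact ⟨m, by omega, by rw [← hm]; simp⟩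

theorem mem_Ioo_of_sq_mem_Ioo {a b x : ℝ} (ha : 0 ≤ a) (hb : 0 ≤ b)
    (hx : x ∈ Ioo (a ^ 2) (b ^ 2)) : 0 < Real.sqrt x ∧ Real.sqrt x ∈ Ioo a b ∧
      Real.sqrt x ^ 2 = x := by
  have h0 : 0 < x := (sq_nonneg a).trans_lt hx.1
  exact ⟨Real.sqrt_pos.mpr h0, ⟨(Real.lt_sqrt ha).mpr hx.1, (Real.sqrt_lt h0.le hb).mpr hx.2⟩,
    Real.sq_sqrt h0.le⟩

theorem coth_sqrt_eq_iff {r : ℝ} (hr : 0 < r) {k : ℤ} (hk : 1 ≤ k) {x : ℝ}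
    (hx : x ∈ Ioo ((((k : ℝ) - 1) * Real.pi) ^ 2) ((k * Real.pi) ^ 2)) :
    coth (Real.sqrt x) = -r * Real.cot (Real.sqrt x) ↔ x = secularRoot r k ^ 2 := by
  have hk' : (1 : ℝ) ≤ k := by exact_mod_cast hk
  have hpi := Real.pi_pos
  obtain ⟨h1, h2, h3⟩ := mem_Ioo_of_sq_mem_Ioo (mul_nonneg (by linarith) hpi.le)
    (by positivity) hx
  rw [coth_eq_iff_secularRoot hr hk h1 h2]
  constructor
  · intro h
    rw [← h, h3]
  · intro h
    rw [h, Real.sqrt_sq (secularRoot_pos hr hk).le]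

theorem secularRoot_sq_mem {r : ℝ} (hr : 0 < r) {k : ℤ} (hk : 1 ≤ k) :
    secularRoot r k ^ 2 ∈ Ioo ((((k : ℝ) - 1) * Real.pi) ^ 2) ((k * Real.pi) ^ 2) := by
  have hk' : (1 : ℝ) ≤ k := by exact_mod_cast hk
  have h := secularRoot_mem hr hk
  exact ⟨pow_lt_pow_left₀ h.1 (mul_nonneg (by linarith) Real.pi_pos.le) (by norm_num),
    pow_lt_pow_left₀ h.2 (secularRoot_pos hr hk).le (by norm_num)⟩

/-- With x = kπ - arctan(r tanh x), the difference of squares is (arctan r - arctan(r tanh x)) times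
a sum that grows with x. The first factor is at most 2r exp(-2x), because arctan is 1-Lipschitz, and
the second is at most 2 exp x, so the product still decays exponentially. -/
theorem tendsto_secularRoot_sq_sub {r : ℝ} (hr : 0 < r) :
    Tendsto (fun k : ℤ => secularRoot r k ^ 2 - (k * Real.pi - Real.arctan r) ^ 2)
      atTop (𝓝 0) := by
  have hb : ∀ k : ℤ, 1 ≤ k →
      ‖secularRoot r k ^ 2 - (k * Real.pi - Real.arctan r) ^ 2‖ ≤
        4 * r * Real.exp (-((k : ℝ) - 1)) := by
    intro k hk
    have hk' : (1 : ℝ) ≤ k := by exact_mod_cast hk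
    set x := secularRoot r k with hx
    have hx0 : 0 < x := secularRoot_pos hr hk
    have hph : x + Real.arctan (r * Real.tanh x) = k * Real.pi := phase_secularRoot hr hk
    have hmem := secularRoot_mem hr hk
    have hpi := Real.pi_gt_three
    have ht1 := (Real.tanh_lt_one x).le
    have hle : r * Real.tanh x ≤ r := by nlinarith
    have hd0 : 0 ≤ Real.arctan r - Real.arctan (r * Real.tanh x) :=
      sub_nonneg.mpr (Real.arctan_strictMono.monotone hle)
    have hd1 : Real.arctan r - Real.arctan (r * Real.tanh x) ≤ r * (2 * Real.exp (-(2 * x))) :=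
      calc _ ≤ r - r * Real.tanh x := Real.arctan_sub_arctan_le hle
        _ = r * (1 - Real.tanh x) := by ring
        _ ≤ _ := by gcongr; exact Real.one_sub_tanh_le x
    have ha := Real.arctan_lt_pi_div_two r
    have ha0 := Real.arctan_pos.mpr hr
    have hpi4 := Real.pi_lt_four
    have hs0 : 0 ≤ x + (k * Real.pi - Real.arctan r) := by nlinarith
    have hb2 := Real.arctan_lt_pi_div_two (r * Real.tanh x)
    -- The summand 1 is slack, added to match x + 1 ≤ exp x.
    have hs1 : x + (k * Real.pi - Real.arctan r) ≤ 2 * (x + 1) := by linarith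
    have hs2 : x + (k * Real.pi - Real.arctan r) ≤ 2 * Real.exp x := by
      linarith [Real.add_one_le_exp x]
    have e : x ^ 2 - (k * Real.pi - Real.arctan r) ^ 2 =
        (Real.arctan r - Real.arctan (r * Real.tanh x)) *
          (x + (k * Real.pi - Real.arctan r)) := by
      rw [← hph]
      ring
    rw [e, Real.norm_of_nonneg (mul_nonneg hd0 hs0)]
    calc _ ≤ r * (2 * Real.exp (-(2 * x))) * (2 * Real.exp x) :=
          mul_le_mul hd1 hs2 hs0 (by positivity)
      _ = 4 * r * (Real.exp (-(2 * x)) * Real.exp x) := by ring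
      _ = 4 * r * Real.exp (-x) := by rw [← Real.exp_add]; ring_nf
      _ ≤ 4 * r * Real.exp (-((k : ℝ) - 1)) := by
        have h1 : (k : ℝ) - 1 ≤ x := by nlinarith [hmem.1]
        have h2 : Real.exp (-x) ≤ Real.exp (-((k : ℝ) - 1)) := Real.exp_le_exp.mpr (by linarith)
        gcongr
  have hlim : Tendsto (fun k : ℤ => 4 * r * Real.exp (-((k : ℝ) - 1))) atTop (𝓝 0) := by
    have h1 : Tendsto (fun k : ℤ => (k : ℝ) - 1) atTop atTop :=
      tendsto_atTop_add_const_right _ (-1) tendsto_intCast_atTop_atTop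
    have h2 := (Real.tendsto_exp_neg_atTop_nhds_zero.comp h1).const_mul (4 * r)
    simpa [Function.comp_def] using h2
  refine squeeze_zero_norm' ?_ hlim
  filter_upwards [eventually_ge_atTop 1] with k hk using hb k hk

section

/-! ## The spectrum -/

theorem eigenDim_mul_pi (N M : ℕ) (k : ℕ) : eigenDim N M (k * Real.pi) = N - 1 := by
  rw [eigenDim, if_pos (Real.sin_nat_mul_pi k)]

theorem secular_div_iff {N M : ℕ} (hM : 1 ≤ M) (x : ℝ) :
    (N : ℝ) / M * (Real.cos x * Real.sinh x) + Real.cosh x * Real.sin x = 0 ↔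
      N * (Real.cos x * Real.sinh x) + M * (Real.cosh x * Real.sin x) = 0 := by
  have hM0 : (M : ℝ) ≠ 0 := by positivity
  have e : N * (Real.cos x * Real.sinh x) + M * (Real.cosh x * Real.sin x) =
      M * ((N : ℝ) / M * (Real.cos x * Real.sinh x) + Real.cosh x * Real.sin x) := by
    field_simp
  rw [e, mul_eq_zero, or_iff_right hM0]

theorem secular_secularRoot {N M : ℕ} (hN : 1 ≤ N) (hM : 1 ≤ M) {k : ℤ} (hk : 1 ≤ k) :
    N * (Real.cos (secularRoot (N / M) k) * Real.sinh (secularRoot (N / M) k)) +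
      M * (Real.cosh (secularRoot (N / M) k) * Real.sin (secularRoot (N / M) k)) = 0 := by
  have hr : (0 : ℝ) < N / M := by positivity
  rw [← secular_div_iff hM, secular_iff_phase hr (secularRoot_pos hr hk) (secularRoot_mem hr hk)]
  exact phase_secularRoot hr hk

theorem eigenDim_secularRoot {N M : ℕ} (hN : 1 ≤ N) (hM : 1 ≤ M) {k : ℤ} (hk : 1 ≤ k) :
    eigenDim N M (secularRoot (N / M) k) = 1 := by
  rw [eigenDim, if_neg (sin_ne_zero_of_mem (secularRoot_mem (by positivity) hk)),
    if_pos (secular_secularRoot hN hM hk)]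

theorem eigenDim_ne_zero {N M : ℕ} (hN : 1 ≤ N) (hM : 1 ≤ M) {s : ℝ} (hs : 0 < s)
    (h : eigenDim N M s ≠ 0) : (2 ≤ N ∧ ∃ k : ℕ, 1 ≤ k ∧ s = k * Real.pi) ∨
      ∃ k : ℤ, 1 ≤ k ∧ s = secularRoot (N / M) k := by
  have hr : (0 : ℝ) < N / M := by positivity
  rw [eigenDim] at h
  split_ifs at h with h1 h2
  · exact Or.inl ⟨by omega, exists_eq_nat_mul_pi hs h1⟩
  · obtain ⟨k, hk, hx⟩ := exists_mem_Ioo_of_sin_ne_zero hs h1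
    refine Or.inr ⟨k, hk, ?_⟩
    rwa [← phase_eq_iff hr hk, ← secular_iff_phase hr hs hx, secular_div_iff hM]
  · exact absurd rfl h

/-- The simple eigenvalues of the indefinite Kirchhoff Laplacian. -/
def simpleEigenvalue (np nm : ℕ) (k : ℤ) : ℝ :=
  -- The index 0 falls into the second branch; its value plays no role.
  if 1 ≤ k then secularRoot (np / nm) k ^ 2 else -secularRoot (nm / np) (-k) ^ 2

variable {np nm : ℕ}

theorem simpleEigenvalue_of_pos {k : ℤ} (hk : 1 ≤ k) :
    simpleEigenvalue np nm k = secularRoot (np / nm) k ^ 2 := if_pos hk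

theorem simpleEigenvalue_of_neg {k : ℤ} (hk : k ≤ -1) :
    simpleEigenvalue np nm k = -secularRoot (nm / np) (-k) ^ 2 := if_neg (by omega)

theorem hasMultiplicity_simpleEigenvalue (hnp : 1 ≤ np) (hnm : 1 ≤ nm) {k : ℤ} (hk : k ≠ 0) :
    HasMultiplicity (indefiniteKirchhoff np nm) (simpleEigenvalue np nm k : ℂ) 1 := by
  rcases lt_or_gt_of_ne hk with h | h
  · rw [simpleEigenvalue_of_neg (by omega), ← eigenDim_secularRoot hnm hnp (k := -k) (by omega)]
    exact hasMultiplicity_neg_sq hnm (secularRoot_pos (by positivity) (by omega))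
  · rw [simpleEigenvalue_of_pos (by omega), ← eigenDim_secularRoot hnp hnm (k := k) (by omega)]
    exact hasMultiplicity_sq hnp (secularRoot_pos (by positivity) (by omega))

theorem hasMultiplicity_mul_pi_sq (hnp : 1 ≤ np) {k : ℕ} (hk : 1 ≤ k) :
    HasMultiplicity (indefiniteKirchhoff np nm) ((((k : ℝ) * Real.pi) ^ 2 : ℝ) : ℂ) (np - 1) := by
  rw [← eigenDim_mul_pi np nm k]
  exact hasMultiplicity_sq hnp (by positivity)

theorem hasMultiplicity_neg_mul_pi_sq (hnm : 1 ≤ nm) {k : ℕ} (hk : 1 ≤ k) :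
    HasMultiplicity (indefiniteKirchhoff np nm) ((-((k : ℝ) * Real.pi) ^ 2 : ℝ) : ℂ) (nm - 1) := by
  rw [← eigenDim_mul_pi nm np k]
  exact hasMultiplicity_neg_sq hnm (by positivity)

theorem opSpectrum_indefiniteKirchhoff (hnp : 1 ≤ np) (hnm : 1 ≤ nm) :
    opSpectrum (indefiniteKirchhoff np nm) =
      {z : ℂ | ∃ k : ℤ, k ≠ 0 ∧ z = (simpleEigenvalue np nm k : ℂ)} ∪
      {z : ℂ | 2 ≤ np ∧ ∃ k : ℕ, 1 ≤ k ∧ z = ((((k : ℝ) * Real.pi) ^ 2 : ℝ) : ℂ)} ∪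
      {z : ℂ | 2 ≤ nm ∧ ∃ k : ℕ, 1 ≤ k ∧ z = ((-((k : ℝ) * Real.pi) ^ 2 : ℝ) : ℂ)} := by
  have hn : 1 ≤ np + nm := by omega
  ext z
  constructor
  · intro hz
    obtain ⟨s, hs, rfl | rfl⟩ := exists_eq_sq_of_mem_opSpectrum hn hz
    · rcases eigenDim_ne_zero hnp hnm hs ((mem_opSpectrum_iff hn (hasMultiplicity_sq hnp hs)).mp hz)
        with ⟨h2, k, hk, rfl⟩ | ⟨k, hk, rfl⟩
      · exact Or.inl (Or.inr ⟨h2, k, hk, rfl⟩)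
      · exact Or.inl (Or.inl ⟨k, by omega, by rw [simpleEigenvalue_of_pos hk]⟩)
    · rcases eigenDim_ne_zero hnm hnp hs
        ((mem_opSpectrum_iff hn (hasMultiplicity_neg_sq hnm hs)).mp hz)
        with ⟨h2, k, hk, rfl⟩ | ⟨k, hk, rfl⟩
      · exact Or.inr ⟨h2, k, hk, rfl⟩
      · exact Or.inl (Or.inl ⟨-k, by omega, by
          rw [simpleEigenvalue_of_neg (by omega), neg_neg]⟩)
  · rintro ((⟨k, hk, rfl⟩ | ⟨h2, k, hk, rfl⟩) | ⟨h2, k, hk, rfl⟩)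
    · exact (mem_opSpectrum_iff hn (hasMultiplicity_simpleEigenvalue hnp hnm hk)).mpr one_ne_zero
    · exact (mem_opSpectrum_iff hn (hasMultiplicity_mul_pi_sq hnp hk)).mpr (by omega)
    · exact (mem_opSpectrum_iff hn (hasMultiplicity_neg_mul_pi_sq hnm hk)).mpr (by omega)

/-- A crude bound, enough to leave only finitely many of the simple eigenvalues in each ball. -/
theorem sub_one_le_secularRoot_sq {r : ℝ} (hr : 0 < r) {k : ℤ} (hk : 1 ≤ k) :
    (k : ℝ) - 1 ≤ secularRoot r k ^ 2 := by
  have hk' : (1 : ℝ) ≤ k := by exact_mod_cast hk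
  rcases hk.eq_or_lt with rfl | h
  · simpa using sq_nonneg _
  · have h1 : (2 : ℝ) ≤ k := by exact_mod_cast h
    have h2 := (secularRoot_mem hr hk).1
    have h3 := Real.pi_gt_three
    have h4 : (k : ℝ) - 1 ≤ secularRoot r k := by nlinarith
    nlinarith

theorem finite_opSpectrum_inter_closedBall (hnp : 1 ≤ np) (hnm : 1 ≤ nm) (R : ℝ) :
    (opSpectrum (indefiniteKirchhoff np nm) ∩ Metric.closedBall 0 R).Finite := by
  have hpi := Real.pi_gt_three
  have hsq : ∀ k : ℕ, 1 ≤ k → ((k : ℝ) * Real.pi) ^ 2 ≤ R → k ≤ ⌈R⌉₊ := by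
    intro k hk h
    have hk' : (1 : ℝ) ≤ k := by exact_mod_cast hk
    have : (k : ℝ) ≤ k * Real.pi := by nlinarith
    have h2 : (k : ℝ) ≤ R := by nlinarith
    exact_mod_cast h2.trans (Nat.le_ceil R)
  refine Set.Finite.subset
    (((finite_Icc (-(⌈R⌉ + 1)) (⌈R⌉ + 1)).image fun k => (simpleEigenvalue np nm k : ℂ)).union
      (((finite_Iic ⌈R⌉₊).image fun k : ℕ => ((((k : ℝ) * Real.pi) ^ 2 : ℝ) : ℂ)).union
        ((finite_Iic ⌈R⌉₊).image fun k : ℕ => ((-((k : ℝ) * Real.pi) ^ 2 : ℝ) : ℂ)))) ?_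
  rintro z ⟨hz, hzR⟩
  rw [mem_closedBall_zero_iff] at hzR
  rw [opSpectrum_indefiniteKirchhoff hnp hnm] at hz
  have hroot : ∀ (r : ℝ) (k : ℤ), 0 < r → 1 ≤ k → secularRoot r k ^ 2 ≤ R → k ≤ ⌈R⌉ + 1 := by
    intro r k hr hk h
    have h1 := (sub_one_le_secularRoot_sq hr hk).trans (h.trans (Int.le_ceil R))
    have h2 : (k : ℝ) ≤ ((⌈R⌉ + 1 : ℤ) : ℝ) := by
      push_cast
      linarith
    exact_mod_cast h2
  rcases hz with (⟨k, hk, rfl⟩ | ⟨-, k, hk, rfl⟩) | ⟨-, k, hk, rfl⟩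
  · refine Or.inl ⟨k, ?_, rfl⟩
    rw [Complex.norm_real] at hzR
    rcases lt_or_gt_of_ne hk with h | h
    · rw [simpleEigenvalue_of_neg (by omega), norm_neg, Real.norm_of_nonneg (sq_nonneg _)] at hzR
      have := hroot _ _ (by positivity) (by omega) hzR
      exact ⟨by omega, by omega⟩
    · rw [simpleEigenvalue_of_pos (by omega), Real.norm_of_nonneg (sq_nonneg _)] at hzR
      have := hroot _ _ (by positivity) (by omega) hzR
      exact ⟨by omega, by omega⟩
  · rw [Complex.norm_real, Real.norm_of_nonneg (sq_nonneg _)] at hzR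
    exact Or.inr (Or.inl ⟨k, hsq k hk hzR, rfl⟩)
  · rw [Complex.norm_real, norm_neg, Real.norm_of_nonneg (sq_nonneg _)] at hzR
    exact Or.inr (Or.inr ⟨k, hsq k hk hzR, rfl⟩)

theorem not_accPt_opSpectrum (hnp : 1 ≤ np) (hnm : 1 ≤ nm) (z : ℂ) :
    ¬ AccPt z (𝓟 (opSpectrum (indefiniteKirchhoff np nm))) := by
  intro h
  have hU : Metric.closedBall (0 : ℂ) (‖z‖ + 1) ∈ 𝓝 z :=
    mem_of_superset (Metric.ball_mem_nhds z one_pos) fun w hw => by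
      rw [mem_closedBall_zero_iff]
      have h1 : ‖w - z‖ < 1 := mem_ball_iff_norm.mp hw
      linarith [norm_le_norm_add_norm_sub z w, norm_sub_rev z w]
  have h2 := h.nhds_inter hU
  rw [inter_comm] at h2
  exact Set.Infinite.of_accPt h2 (finite_opSpectrum_inter_closedBall hnp hnm _)

theorem hasPurelyDiscreteSpectrum_indefiniteKirchhoff (hnp : 1 ≤ np) (hnm : 1 ≤ nm) :
    HasPurelyDiscreteSpectrum (indefiniteKirchhoff np nm) := by
  have hn : 1 ≤ np + nm := by omega
  refine ⟨not_accPt_opSpectrum hnp hnm, fun z hz => ⟨?_, ?_, isClosed_range_shift np nm z⟩⟩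
  · rwa [← opSpectrum_eq_pointSpectrum hn]
  · obtain ⟨s, hs, h⟩ := exists_eq_sq_of_mem_opSpectrum hn hz
    have hm : ∃ m : ℕ, HasMultiplicity (indefiniteKirchhoff np nm) z m := by
      rcases h with rfl | rfl
      · exact ⟨_, hasMultiplicity_sq hnp hs⟩
      · exact ⟨_, hasMultiplicity_neg_sq hnm hs⟩
    obtain ⟨m, hm⟩ := hm
    have : Module.rank ℂ (rootSubspace (indefiniteKirchhoff np nm) z) < Cardinal.aleph0 := by
      rw [hm.2]
      exact Cardinal.natCast_lt_aleph0
    exact Module.rank_lt_aleph0_iff.mp this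

/-- For equal edge counts the multiplicities at s² and -s² are given by the same formula. -/
theorem neg_mem_opSpectrum_of_eq {n : ℕ} (hn : 1 ≤ n) {z : ℂ}
    (hz : z ∈ opSpectrum (indefiniteKirchhoff n n)) :
    -z ∈ opSpectrum (indefiniteKirchhoff n n) := by
  have hnn : 1 ≤ n + n := by omega
  obtain ⟨s, hs, rfl | rfl⟩ := exists_eq_sq_of_mem_opSpectrum hnn hz
  · rw [mem_opSpectrum_iff hnn (hasMultiplicity_sq hn hs)] at hz
    rw [← Complex.ofReal_neg]
    exact (mem_opSpectrum_iff hnn (hasMultiplicity_neg_sq hn hs)).mpr hz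
  · rw [mem_opSpectrum_iff hnn (hasMultiplicity_neg_sq hn hs)] at hz
    rw [← Complex.ofReal_neg, neg_neg]
    exact (mem_opSpectrum_iff hnn (hasMultiplicity_sq hn hs)).mpr hz

theorem eq_of_opSpectrum_symm (hnp : 1 ≤ np) (hnm : 1 ≤ nm)
    (h : ∀ z ∈ opSpectrum (indefiniteKirchhoff np nm),
      -z ∈ opSpectrum (indefiniteKirchhoff np nm)) :
    np = nm := by
  have hn : 1 ≤ np + nm := by omega
  have hr : (0 : ℝ) < np / nm := by positivity
  have h1 := secular_secularRoot hnp hnm (k := 1) le_rfl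
  have hs := secularRoot_pos hr (k := 1) le_rfl
  have hsin := sin_ne_zero_of_mem (secularRoot_mem hr (k := 1) le_rfl)
  have hd := eigenDim_secularRoot hnp hnm (k := 1) le_rfl
  set s := secularRoot (np / nm) 1
  have hm := h _ ((mem_opSpectrum_iff hn (hasMultiplicity_sq hnp hs)).mpr (by rw [hd]; norm_num))
  rw [← Complex.ofReal_neg, mem_opSpectrum_iff hn (hasMultiplicity_neg_sq hnm hs), eigenDim,
    if_neg hsin] at hm
  -- As sin s ≠ 0, the point -s² can be in the spectrum only through the secular equation with the
  -- edge counts exchanged.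
  have h2 : nm * (Real.cos s * Real.sinh s) + np * (Real.cosh s * Real.sin s) = 0 := by
    by_contra hc
    exact hm (if_neg hc)
  by_contra hne
  have hne' : (np : ℝ) - nm ≠ 0 := sub_ne_zero.mpr (by exact_mod_cast hne)
  -- If the counts differ, the difference of the two equations gives cos s sinh s = cosh s sin s,
  -- and the first one then becomes (np + nm) cosh s sin s = 0, which is impossible.
  have h3 : ((np : ℝ) - nm) * (Real.cos s * Real.sinh s - Real.cosh s * Real.sin s) = 0 := by
    linear_combination h1 - h2
  have h4 := (mul_eq_zero.mp h3).resolve_left hne'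
  have h5 : ((np : ℝ) + nm) * (Real.cosh s * Real.sin s) = 0 := by
    linear_combination h1 - np * h4
  have h6 : (np : ℝ) + nm ≠ 0 := by positivity
  exact mul_ne_zero h6 (mul_ne_zero (Real.cosh_pos s).ne' hsin) h5

end

end StarGraph

end

/-! ### The main theorem -/

open UnboundedOperator StarGraph in
theorem mainTheorem2 (np nm : ℕ) (hnp : 1 ≤ np) (hnm : 1 ≤ nm) :
    IsKreinPositive np nm (indefiniteKirchhoff np nm) ∧
    (0 : ℂ) ∈ resolventSet (indefiniteKirchhoff np nm) ∧
    HasPurelyDiscreteSpectrum (indefiniteKirchhoff np nm) ∧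
    (∀ z ∈ opSpectrum (indefiniteKirchhoff np nm), z.im = 0) ∧
    opSpectrum (indefiniteKirchhoff np nm) = pointSpectrum (indefiniteKirchhoff np nm) ∧
    (∃ η : ℤ → ℝ,
      -- for `k ≥ 1`, `η k` is the unique solution of the first equation in its gap
      (∀ k : ℤ, 1 ≤ k → ∀ x ∈ Set.Ioo ((((k : ℝ) - 1) * Real.pi) ^ 2) (((k : ℝ) * Real.pi) ^ 2),
        (coth (Real.sqrt x) = -((np : ℝ) / nm) * Real.cot (Real.sqrt x) ↔ x = η k)) ∧
      (∀ k : ℤ, 1 ≤ k →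
        η k ∈ Set.Ioo ((((k : ℝ) - 1) * Real.pi) ^ 2) (((k : ℝ) * Real.pi) ^ 2)) ∧
      -- for `k ≤ -1`, `η k` is the unique solution of the second equation in its gap
      (∀ k : ℤ, k ≤ -1 →
        ∀ x ∈ Set.Ioo (-((k : ℝ) * Real.pi) ^ 2) (-(((k : ℝ) + 1) * Real.pi) ^ 2),
        (coth (Real.sqrt (-x)) = -((nm : ℝ) / np) * Real.cot (Real.sqrt (-x)) ↔ x = η k)) ∧
      (∀ k : ℤ, k ≤ -1 →
        η k ∈ Set.Ioo (-((k : ℝ) * Real.pi) ^ 2) (-(((k : ℝ) + 1) * Real.pi) ^ 2)) ∧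
      -- the spectrum as a set
      opSpectrum (indefiniteKirchhoff np nm) =
        {z : ℂ | ∃ k : ℤ, k ≠ 0 ∧ z = (η k : ℂ)} ∪
        {z : ℂ | 2 ≤ np ∧ ∃ k : ℕ, 1 ≤ k ∧ z = ((((k : ℝ) * Real.pi) ^ 2 : ℝ) : ℂ)} ∪
        {z : ℂ | 2 ≤ nm ∧ ∃ k : ℕ, 1 ≤ k ∧ z = ((-((k : ℝ) * Real.pi) ^ 2 : ℝ) : ℂ)} ∧
      -- the multiplicities
      (∀ k : ℤ, k ≠ 0 → HasMultiplicity (indefiniteKirchhoff np nm) (η k : ℂ) 1) ∧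
      (∀ k : ℕ, 1 ≤ k → HasMultiplicity (indefiniteKirchhoff np nm)
        ((((k : ℝ) * Real.pi) ^ 2 : ℝ) : ℂ) (np - 1)) ∧
      (∀ k : ℕ, 1 ≤ k → HasMultiplicity (indefiniteKirchhoff np nm)
        ((-((k : ℝ) * Real.pi) ^ 2 : ℝ) : ℂ) (nm - 1)) ∧
      -- the asymptotics
      Filter.Tendsto (fun k : ℤ => η k - ((k : ℝ) * Real.pi - Real.arctan ((np : ℝ) / nm)) ^ 2)
        Filter.atTop (nhds 0) ∧
      Filter.Tendsto
        (fun k : ℤ => η k - (-(|(k : ℝ)| * Real.pi - Real.arctan ((nm : ℝ) / np)) ^ 2))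
        Filter.atBot (nhds 0)) ∧
    ((∀ z : ℂ, z ∈ opSpectrum (indefiniteKirchhoff np nm) ↔
        -z ∈ opSpectrum (indefiniteKirchhoff np nm)) ↔ np = nm) := by
  have hn : 1 ≤ np + nm := by omega
  have hp0 : (0 : ℝ) < np / nm := by positivity
  have hm0 : (0 : ℝ) < nm / np := by positivity
  refine ⟨isKreinPositive_indefiniteKirchhoff hn, zero_mem_resolventSet hn,
    hasPurelyDiscreteSpectrum_indefiniteKirchhoff hnp hnm,
    fun z hz => im_eq_zero_of_mem_pointSpectrum (by rwa [← opSpectrum_eq_pointSpectrum hn]),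
    opSpectrum_eq_pointSpectrum hn, ⟨simpleEigenvalue np nm, ?_, ?_, ?_, ?_,
      opSpectrum_indefiniteKirchhoff hnp hnm,
      fun k hk => hasMultiplicity_simpleEigenvalue hnp hnm hk,
      fun k hk => hasMultiplicity_mul_pi_sq hnp hk,
      fun k hk => hasMultiplicity_neg_mul_pi_sq hnm hk, ?_, ?_⟩, ?_⟩
  · intro k hk x hx
    rw [simpleEigenvalue_of_pos hk]
    exact coth_sqrt_eq_iff hp0 hk hx
  · intro k hk
    rw [simpleEigenvalue_of_pos hk]
    exact secularRoot_sq_mem hp0 hk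
  · intro k hk x hx
    -- Reflecting both x and `k` turns the gap for `k ≤ -1` into the positive gap of index `-k`,
    -- with the ratio inverted.
    rw [simpleEigenvalue_of_neg hk, ← neg_eq_iff_eq_neg]
    refine coth_sqrt_eq_iff hm0 (k := -k) (by omega) ?_
    push_cast
    exact ⟨by linarith [hx.2], by linarith [hx.1]⟩
  · intro k hk
    rw [simpleEigenvalue_of_neg hk]
    have h := secularRoot_sq_mem hm0 (k := -k) (by omega)
    push_cast at h
    exact ⟨by linarith [h.2], by linarith [h.1]⟩
  · refine (tendsto_secularRoot_sq_sub hp0).congr' ?_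
    filter_upwards [Filter.eventually_ge_atTop 1] with k hk
    rw [simpleEigenvalue_of_pos hk]
  · have h := ((tendsto_secularRoot_sq_sub hm0).comp Filter.tendsto_neg_atBot_atTop).neg
    rw [neg_zero] at h
    refine h.congr' ?_
    filter_upwards [Filter.eventually_le_atBot (-1)] with k hk
    have hk' : (k : ℝ) < 0 := by exact_mod_cast (show k < 0 by omega)
    rw [simpleEigenvalue_of_neg hk, abs_of_neg hk']
    simp only [Function.comp_apply]
    push_cast
    ring
  · constructor
    · intro h
      exact eq_of_opSpectrum_symm hnp hnm fun z hz => (h z).mp hz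
    · rintro rfl z
      exact ⟨neg_mem_opSpectrum_of_eq hnp, fun hz => by
        simpa using neg_mem_opSpectrum_of_eq hnp hz⟩
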